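/- Let $(Z_t)_{t\in\mathbb Z}$ be i.i.d. real random variables with $\mathbb E Z_0=0$ and $\mathbb E Z_0^2=1$, and put $\mathcal F_t=\sigma(Z_k;\,k\le t)$. Let $((X_t,\sigma_t))_{t\in\mathbb Z}$ be a stationary EGARCH process with parameter $\theta_0=(\alpha_0,\beta_0,\gamma_0,\delta_0)^T\in\mathbb R^4$, that is, a strictly stationary process such that $\sigma_t>0$ is $\mathcal F_{t-1}$-measurable and, almost surely for every $t\in\mathbb Z$, $$X_t=\sigma_tZ_t,\qquad \log\sigma_t^2=\alpha_0+\beta_0\log\sigma_{t-1}^2+\gamma_0Z_{t-1}+\delta_0|Z_{t-1}| .$$ Assume that $0\le\beta_0<1$, $\delta_0\ge|\gamma_0|$, $(\gamma_0,\delta_0)\ne(0,0)$, and that the distribution of $Z_0$ is not concentrated at two points, i.e. $\mathbb P(Z_0\in\{a,b\})<1$ for all $a,b\in\mathbb R$ (not necessarily distinct). Let $K$ be a compact subset of $\Theta=\{(\alpha,\beta,\gamma,\delta)^T\in\mathbb R^4:\ 0\le\beta<1,\ \delta\ge|\gamma|\}$ with $\theta_0\in K$. Put $m=\inf_{\theta\in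 K}\alpha(1-\beta)^{-1}$, $$\lambda_0(\theta)=\max\bigl(\beta,\ 2^{-1}e^{-m/2}(\gamma X_0+\delta|X_0|)-\beta\bigr),\qquad \|\lambda_0\|_K=\sup_{\theta\in K}|\lambda_0(\theta)|,$$ and assume that $\mathbb E(\log\|\lambda_0\|_K)<0$, where $\log 0=-\infty$ and the expectation may equal $-\infty$. Fix an initial value $\varsigma_0^2>0$. For $\theta=(\alpha,\beta,\gamma,\delta)^T\in K$ define $\hat h_0(\theta)=\varsigma_0^2$, $$\log\hat h_{t+1}(\theta)=\alpha+\beta\log\hat h_t(\theta)+(\gamma X_t+\delta|X_t|)\,\hat h_t(\theta)^{-1/2},\quad t\ge0,\qquad \hat L_n(\theta)=-\frac12\sum_{t=1}^n\Bigl(\frac{X_t^2}{\hat h_t(\theta)}+\log\hat h_t(\theta)\Bigr).$$ Then $\hat L_n$ attains its maximum on $K$ for every $n$ and every realization, and the quasi-maximum-likelihood estimator is strongly consistent: for every sequence $(\hat\theta_n)_{n\ge1}$ such that, for each $n\ge1$, almost surely $\hat\theta_n\in K$ and $\hat L_n(\hat\theta_n)=\max_{\theta\in K}\hat L_n(\theta)$,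 one has $\hat\theta_n\to\theta_0$ almost surely as $n\to\infty$. -/

import Mathlib

open MeasureTheory ProbabilityTheory Filter Topology
open scoped ENNReal

namespace EGARCH

/-- Parameter vectors `θ = (α, β, γ, δ)ᵀ ∈ ℝ⁴`. -/
abbrev Param : Type := EuclideanSpace ℝ (Fin 4)

/-- The coordinate `α`. -/
abbrev Param.α (θ : Param) : ℝ := θ 0

/-- The coordinate `β`. -/
abbrev Param.β (θ : Param) : ℝ := θ 1

/-- The coordinate `γ`. -/
abbrev Param.γ (θ : Param) : ℝ := θ 2

/-- The coordinate `δ`. -/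
abbrev Param.δ (θ : Param) : ℝ := θ 3

/-- The parameter space `Θ = ℝ × [0, 1) × {(γ, δ) | δ ≥ |γ|}`. -/
def paramSpace : Set Param := {θ | 0 ≤ θ.β ∧ θ.β < 1 ∧ |θ.γ| ≤ θ.δ}

section Model

variable {Ω : Type*} [MeasurableSpace Ω]

/-- Strict stationarity of a two-sided sequence: for every `h` the laws of `(Y_{t+h})_t` and of
`(Y_t)_t` on the sequence space coincide. -/
def IsStationary {E : Type*} [MeasurableSpace E] (P : Measure Ω) (Y : ℤ → Ω → E) : Prop :=
  ∀ h : ℤ, IdentDistrib (fun ω (t : ℤ) => Y (t + h) ω) (fun ω (t : ℤ) => Y t ω) P P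

/-- The σ-field `𝓕_t = σ(Z_k ; k ≤ t)`. -/
abbrev past (Z : ℤ → Ω → ℝ) (t : ℤ) : MeasurableSpace Ω :=
  ⨆ k : {k : ℤ // k ≤ t}, MeasurableSpace.comap (Z k) inferInstance

/-- `((X_t, σ_t))_{t ∈ ℤ}` is a stationary EGARCH process with parameter `θ` and innovations
`(Z_t)`. -/
structure IsStationaryEGARCH (P : Measure Ω) (θ : Param) (Z X σ : ℤ → Ω → ℝ) : Prop where
  measurable_Z : ∀ t, Measurable (Z t)
  /-- The innovations are independent, ... -/
  indep : iIndepFun Z P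
  /-- ... identically distributed, ... -/
  identDistrib : ∀ t, IdentDistrib (Z t) (Z 0) P P
  /-- ... centred, with variance one. -/
  memLp : MemLp (Z 0) 2 P
  mean : ∫ ω, Z 0 ω ∂P = 0
  variance : ∫ ω, (Z 0 ω) ^ 2 ∂P = 1
  /-- The volatility `σ_t` is `𝓕_{t-1}`-measurable ... -/
  measurable_σ : ∀ t, Measurable[past Z (t - 1)] (σ t)
  /-- ... and positive. -/
  pos : ∀ t, ∀ᵐ ω ∂P, 0 < σ t ω
  /-- `log σ_t² = α + β log σ_{t-1}² + γ Z_{t-1} + δ |Z_{t-1}|`. -/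
  recursion : ∀ t, ∀ᵐ ω ∂P, Real.log (σ t ω ^ 2) =
    θ.α + θ.β * Real.log (σ (t - 1) ω ^ 2) + θ.γ * Z (t - 1) ω + θ.δ * |Z (t - 1) ω|
  measurable_X : ∀ t, Measurable (X t)
  /-- `X_t = σ_t Z_t`. -/
  eq_mul : ∀ t, ∀ᵐ ω ∂P, X t ω = σ t ω * Z t ω
  stationary : IsStationary P (fun t ω => (X t ω, σ t ω))

/-- The expectation of the extended-real-valued random variable `f` exists in `[-∞, ∞)` and is
strictly negative, that is, `E f⁺ < E f⁻` (the value `E f⁻ = ∞` is allowed, `E f⁺ = ∞` is not). -/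
def HasNegativeMean (P : Measure Ω) (f : Ω → EReal) : Prop :=
  ∫⁻ ω, (f ω).toENNReal ∂P < ∫⁻ ω, (-f ω).toENNReal ∂P

end Model

/-- The logarithm of a nonnegative real number, with `log 0 = -∞`. -/
noncomputable def extLog (x : ℝ) : EReal := ENNReal.log (ENNReal.ofReal x)

/-- `m = inf_{θ ∈ K} α / (1 - β)`. -/
noncomputable def lowerBound (K : Set Param) : ℝ := ⨅ θ : K, (θ : Param).α / (1 - (θ : Param).β)

/-- The Lipschitz-coefficient bound
`λ₀(θ) = max (β, 2⁻¹ exp (-m / 2) (γ x + δ |x|) - β)`, where `x` is the value of `X_0`. -/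
noncomputable def lipBound (K : Set Param) (x : ℝ) (θ : Param) : ℝ :=
  max θ.β (2⁻¹ * Real.exp (-lowerBound K / 2) * (θ.γ * x + θ.δ * |x|) - θ.β)

/-- The supremum norm `‖f‖_K = sup_{θ ∈ K} |f θ|` (for `f` bounded on the nonempty set `K`). -/
noncomputable def supNorm (K : Set Param) (f : Param → ℝ) : ℝ := ⨆ θ : K, |f θ|

/-- The volatility estimate `ĥ_t(θ)` computed from the data `x` and the initial value `ς² > 0`:
`ĥ_0 = ς²` and
`log ĥ_{t+1} = α + β log ĥ_t + (γ x_t + δ |x_t|) exp (-(log ĥ_t) / 2)`. -/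
noncomputable def hHat (s : ℝ) (x : ℤ → ℝ) (θ : Param) : ℕ → ℝ
  | 0 => s
  | t + 1 => Real.exp (θ.α + θ.β * Real.log (hHat s x θ t) +
      (θ.γ * x t + θ.δ * |x t|) * Real.exp (-Real.log (hHat s x θ t) / 2))

/-- The conditional Gaussian quasi-log-likelihood
`L̂_n(θ) = -½ ∑_{t=1}^n (x_t² / ĥ_t(θ) + log ĥ_t(θ))`. -/
noncomputable def logLik (s : ℝ) (x : ℤ → ℝ) (n : ℕ) (θ : Param) : ℝ :=
  -(1 / 2) * ∑ t ∈ Finset.Icc 1 n, ((x t) ^ 2 / hHat s x θ t + Real.log (hHat s x θ t))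

/-- `θ` is a quasi-maximum-likelihood estimate on `K` from the data `x` at sample size `n`. -/
def IsQMLE (s : ℝ) (x : ℤ → ℝ) (K : Set Param) (n : ℕ) (θ : Param) : Prop :=
  θ ∈ K ∧ IsMaxOn (logLik s x n) K θ

end EGARCH

/-! A stationary EGARCH process is almost surely a fixed function `egarch` of its innovations
(`ae_eq_egarch`), so the argument takes place under the law `iidLaw` of an i.i.d. sequence, where
the shift is ergodic (`ergodic_seqShift`).

Above `lowerBound K` the data recursion `logStep` is Lipschitz with random coefficient `lipSup`
(`abs_logStep_sub_le`). Its logarithm has negative mean, so products of coefficients decay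
geometrically, both forwards and backwards in time (`ae_isContractive`). Backward decay lets the
recursion run from the infinite past, which gives a log-volatility `statLog` continuous in θ.
Forward decay makes the estimates forget their initial value uniformly on K
(`exists_abs_log_hHat_sub_statLog_le`) and shows that `statLog` at θ₀ is the true log-volatility
(`ae_statLog_eq_logVol`).

Let L be the true and l a candidate log-volatility. As Z_0 is independent of the past and E Z_0² =
1, the expected likelihood contribution is E exp(L - l) + E l ≥ 1 + E L, with equality only if l = L
almost surely (`lt_lintegral_statLik`). Then both recursions agree, and independence with
nondegeneracy of Z_0 forces θ = θ₀ (`eq_of_ae_statLog_eq_logVol`).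

Consistency follows by Wald's compactness argument: by Fatou the strict inequality survives an
infimum over a small ball, so that ball eventually contains no maximizer
(`exists_ball_ae_eventually_logLik_lt`), and finitely many balls cover K away from θ₀. Only
one-sided bounds on averages occur, so the upper half of the ergodic theorem
(`ae_eventually_birkhoffSum_le`) suffices. -/

namespace EGARCH

/-! ### Maximal Birkhoff sums and the upper ergodic theorem -/

section Ergodic

open scoped symmDiff

variable {S : Type*} {T : S → S} {f : S → ℝ}

/-- The maximum of the first Birkhoff sums, including the empty one. -/
def maxBirkhoff (T : S → S) (f : S → ℝ) : ℕ → S → ℝ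
  | 0, _ => 0
  | n + 1, x => max 0 (f x + maxBirkhoff T f n (T x))

lemma maxBirkhoff_nonneg (n : ℕ) (x : S) : 0 ≤ maxBirkhoff T f n x := by
  cases n <;> simp [maxBirkhoff]

lemma maxBirkhoff_le_succ (n : ℕ) (x : S) : maxBirkhoff T f n x ≤ maxBirkhoff T f (n + 1) x := by
  induction n generalizing x with
  | zero => simp [maxBirkhoff]
  | succ n ih =>
    rw [maxBirkhoff, maxBirkhoff]
    exact max_le_max le_rfl (add_le_add le_rfl (ih (T x)))

lemma birkhoffSum_le_maxBirkhoff (n : ℕ) (x : S) : birkhoffSum T f n x ≤ maxBirkhoff T f n x := by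
  induction n generalizing x with
  | zero => simp [maxBirkhoff]
  | succ n ih =>
    rw [birkhoffSum_succ', maxBirkhoff]
    exact le_max_of_le_right (by simpa using ih (T x))

variable [MeasurableSpace S] {μ : Measure S}

lemma measurable_maxBirkhoff (hT : Measurable T) (hf : Measurable f) (n : ℕ) :
    Measurable (maxBirkhoff T f n) := by
  induction n with
  | zero => exact measurable_const
  | succ n ih => exact measurable_const.max (hf.add (ih.comp hT))

lemma integrable_maxBirkhoff [IsFiniteMeasure μ] (hT : MeasurePreserving T μ μ)
    (hf : Integrable f μ) (n : ℕ) : Integrable (maxBirkhoff T f n) μ := by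
  induction n with
  | zero => exact integrable_const 0
  | succ n ih => exact (integrable_const 0).sup (hf.add (hT.integrable_comp_of_integrable ih))

/-- If an integrable function has negative mean, its Birkhoff sums along an ergodic transformation
are almost surely bounded above. -/
theorem ae_bddAbove_birkhoffSum [IsProbabilityMeasure μ] (hT : Ergodic T μ) (hfm : Measurable f)
    (hf : Integrable f μ) (hneg : ∫ x, f x ∂μ < 0) :
    ∀ᵐ x ∂μ, BddAbove (Set.range fun n => birkhoffSum T f n x) := by
  -- Boundedness of the maximal sums is a shift-invariant event, so by ergodicity it has probability
  -- zero or one.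
  set A : Set S := {x | BddAbove (Set.range fun n => maxBirkhoff T f n x)} with hA
  have hAm : MeasurableSet A :=
    measurableSet_bddAbove_range fun n => measurable_maxBirkhoff hT.measurable hfm n
  have hAinv : T ⁻¹' A = A := by
    ext x
    constructor
    · rintro ⟨b, hb⟩
      refine ⟨max 0 (f x + b), ?_⟩
      rintro _ ⟨n, rfl⟩
      cases n with
      | zero => simp [maxBirkhoff]
      | succ n => exact max_le_max le_rfl (add_le_add le_rfl (hb ⟨n, rfl⟩))
    · rintro ⟨b, hb⟩
      refine ⟨b - f x, ?_⟩
      rintro _ ⟨n, rfl⟩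
      have h1 : maxBirkhoff T f (n + 1) x ≤ b := hb ⟨n + 1, rfl⟩
      have h2 : f x + maxBirkhoff T f n (T x) ≤ maxBirkhoff T f (n + 1) x := le_max_right _ _
      show maxBirkhoff T f n (T x) ≤ b - f x
      linarith
  rcases hT.toPreErgodic.ae_mem_or_ae_notMem hAm hAinv with h | h
  · filter_upwards [h] with x ⟨b, hb⟩
    refine ⟨b, ?_⟩
    rintro _ ⟨n, rfl⟩
    exact (birkhoffSum_le_maxBirkhoff n x).trans (hb ⟨n, rfl⟩)
  -- If the maximal sums M_n diverge almost surely, then max(-M_n ∘ T, f) tends to f, dominated by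
  -- |f|. But this maximum equals M_{n+1} - M_n ∘ T, whose integral is nonnegative because T
  -- preserves μ and M_n increases in n. This contradicts the negative mean of f.
  · exfalso
    have hint := fun n => integrable_maxBirkhoff (f := f) hT.toMeasurePreserving hf n
    have hintT : ∀ n, Integrable (fun x => maxBirkhoff T f n (T x)) μ := fun n =>
      hT.toMeasurePreserving.integrable_comp_of_integrable (hint n)
    have hlim : Tendsto (fun n => ∫ x, max (-maxBirkhoff T f n (T x)) (f x) ∂μ) atTop
        (𝓝 (∫ x, f x ∂μ)) := by
      refine tendsto_integral_of_dominated_convergence (fun x => |f x|) (fun n => ?_) hf.abs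
        (fun n => ?_) ?_
      · exact (((measurable_maxBirkhoff hT.measurable hfm n).comp hT.measurable).neg.max
          hfm).aestronglyMeasurable
      · filter_upwards with x
        rw [Real.norm_eq_abs, abs_le]
        have := maxBirkhoff_nonneg (T := T) (f := f) n (T x)
        exact ⟨(neg_abs_le _).trans (le_max_right _ _),
          max_le (by linarith [abs_nonneg (f x)]) (le_abs_self _)⟩
      · filter_upwards [h] with x hx
        have hx' : T x ∉ A := fun h' => hx (by rw [← hAinv]; exact h')
        have hmono : Monotone fun n => maxBirkhoff T f n (T x) :=
          monotone_nat_of_le_succ fun n => maxBirkhoff_le_succ n (T x)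
        have htop := tendsto_atTop_atTop_of_monotone' hmono hx'
        refine tendsto_const_nhds.congr' ?_
        filter_upwards [htop.eventually_ge_atTop (-f x)] with n hn
        exact (max_eq_right (by linarith)).symm
    refine absurd (ge_of_tendsto' hlim fun n => ?_) (not_le.mpr hneg)
    have h1 : ∀ x, max (-maxBirkhoff T f n (T x)) (f x)
        = maxBirkhoff T f (n + 1) x - maxBirkhoff T f n (T x) := by
      intro x
      rw [maxBirkhoff, ← max_sub_sub_right]
      simp
    simp_rw [h1]
    rw [integral_sub (hint (n + 1)) (hintT n)]
    have h2 : ∫ x, maxBirkhoff T f n (T x) ∂μ = ∫ x, maxBirkhoff T f n x ∂μ := by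
      have := integral_map (μ := μ) hT.measurable.aemeasurable
        (f := maxBirkhoff T f n) (measurable_maxBirkhoff hT.measurable hfm n).aestronglyMeasurable
      rw [hT.map_eq] at this
      exact this.symm
    rw [h2, sub_nonneg]
    exact integral_mono (hint n) (hint (n + 1)) (maxBirkhoff_le_succ n)

/-- The upper half of the pointwise ergodic theorem. -/
theorem ae_eventually_birkhoffSum_le [IsProbabilityMeasure μ] (hT : Ergodic T μ)
    (hfm : Measurable f) (hf : Integrable f μ) {c : ℝ} (hc : ∫ x, f x ∂μ < c) :
    ∀ᵐ x ∂μ, ∀ᶠ n : ℕ in atTop, birkhoffSum T f n x ≤ c * n := by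
  -- The sums of f - c' are bounded, and the slack (c - c') n eventually exceeds the bound.
  obtain ⟨c', h1, h2⟩ := exists_between hc
  have hneg : ∫ x, (f x - c') ∂μ < 0 := by
    rw [integral_sub hf (integrable_const _)]
    simpa using h1
  filter_upwards [ae_bddAbove_birkhoffSum hT (hfm.sub_const c') (hf.sub (integrable_const c'))
    hneg] with x ⟨b, hb⟩
  have htop : Tendsto (fun n : ℕ => (c - c') * (n : ℝ)) atTop atTop :=
    tendsto_natCast_atTop_atTop.const_mul_atTop (sub_pos.mpr h2)
  filter_upwards [htop.eventually_ge_atTop b] with n hn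
  have h3 : birkhoffSum T (fun x => f x - c') n x ≤ b := hb ⟨n, rfl⟩
  have h4 : birkhoffSum T (fun x => f x - c') n x = birkhoffSum T f n x - n * c' := by
    simp [birkhoffSum, Finset.sum_sub_distrib]
  linarith

end Ergodic

/-! ### Ergodicity of the shift on i.i.d. sequences -/

section Shift

open scoped symmDiff

/-- The shift by `t` on two-sided sequences. -/
def seqShift (t : ℤ) (z : ℤ → ℝ) : ℤ → ℝ := fun k => z (k + t)

lemma measurable_seqShift (t : ℤ) : Measurable (seqShift t) :=
  measurable_pi_lambda _ fun k => measurable_pi_apply (k + t)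

lemma seqShift_seqShift (s t : ℤ) (z : ℤ → ℝ) :
    seqShift s (seqShift t z) = seqShift (s + t) z := by
  funext k
  simp [seqShift, add_assoc]

lemma seqShift_iterate (t : ℤ) (n : ℕ) : (seqShift t)^[n] = seqShift (n * t) := by
  induction n with
  | zero => funext z k; simp [seqShift]
  | succ n ih =>
    funext z
    rw [Function.iterate_succ', Function.comp_apply, ih, seqShift_seqShift]
    push_cast
    congr 1
    ring

/-- The law of an i.i.d. sequence. -/
noncomputable abbrev iidLaw (ν : Measure ℝ) : Measure (ℤ → ℝ) := Measure.infinitePi fun _ : ℤ => ν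

variable {ν : Measure ℝ} [IsProbabilityMeasure ν]

lemma measurePreserving_seqShift (t : ℤ) :
    MeasurePreserving (seqShift t) (iidLaw ν) (iidLaw ν) :=
  ⟨measurable_seqShift t, Measure.map_infinitePi_infinitePi_of_inj (P := fun _ : ℤ => ν)
    (f := fun k : ℤ => k + t) (add_left_injective t)⟩

lemma iIndepFun_eval : iIndepFun (fun (k : ℤ) (z : ℤ → ℝ) => z k) (iidLaw ν) :=
  iIndepFun_infinitePi (P := fun _ : ℤ => ν) (X := fun _ x => x) fun _ => measurable_id

/-- Cylinders over a finite set of coordinates become independent of their distant shifts. -/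
lemma measure_cylinder_inter_seqShift {I : Finset ℤ} {B : Set (I → ℝ)} (hB : MeasurableSet B)
    {N : ℤ} (hN : Disjoint I (I.image fun i => i + N)) :
    iidLaw ν (cylinder I B ∩ seqShift N ⁻¹' cylinder I B)
      = iidLaw ν (cylinder I B) * iidLaw ν (cylinder I B) := by
  have hind := (iIndepFun_eval (ν := ν)).indepFun_finset I (I.image fun i => i + N) hN
    (fun k => measurable_pi_apply k)
  let r : ((I.image fun i => i + N : Finset ℤ) → ℝ) → (I → ℝ) := fun y i =>
    y ⟨i + N, Finset.mem_image_of_mem _ i.2⟩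
  have hr : Measurable r := measurable_pi_lambda _ fun i => measurable_pi_apply _
  have h := (hind.comp measurable_id hr).measure_inter_preimage_eq_mul B B hB hB
  have h2 : iidLaw ν (seqShift N ⁻¹' cylinder I B) = iidLaw ν (cylinder I B) :=
    (measurePreserving_seqShift N).measure_preimage (hB.cylinder I).nullMeasurableSet
  calc _ = _ := h
    _ = iidLaw ν (cylinder I B) * iidLaw ν (seqShift N ⁻¹' cylinder I B) := rfl
    _ = _ := by rw [h2]

/-- The shift is ergodic with respect to the law of an i.i.d. sequence. -/
theorem ergodic_seqShift {t : ℤ} (ht : t ≠ 0) : Ergodic (seqShift t) (iidLaw ν) := by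
  refine ⟨measurePreserving_seqShift t, ⟨fun A hA hinv => ?_⟩⟩
  set μ := iidLaw ν
  -- Mixing argument: approximate A within ε by a cylinder B. A distant shift of B is independent of
  -- B, while A is invariant, so P(B) and P(B)² are within ε and 2ε of P(A). Hence P(A) = P(A)².
  have key : ∀ ε : ℝ, 0 < ε → |μ.real A - μ.real A * μ.real A| ≤ 4 * ε := by
    intro ε hε
    obtain ⟨B, hB, hBA⟩ := exists_measure_symmDiff_lt_of_generateFrom_isSetRing (μ := μ)
      isSetRing_measurableCylinders
      ⟨{Set.univ}, Set.countable_singleton _, by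
        simpa using univ_mem_measurableCylinders (fun _ : ℤ => ℝ), by simp⟩
      generateFrom_measurableCylinders.symm hA (ENNReal.ofReal_pos.mpr hε)
    obtain ⟨I, S, hS, rfl⟩ := (mem_measurableCylinders B).mp hB
    obtain ⟨N, hN⟩ : ∃ N : ℕ, Disjoint I (I.image fun i => i + N * t) := by
      -- This exceeds every difference of two indices in I, so the shifted index set misses I.
      refine ⟨2 * I.sup Int.natAbs + 1, Finset.disjoint_left.mpr fun i hi hi' => ?_⟩
      obtain ⟨j, hj, hji⟩ := Finset.mem_image.mp hi'
      have h1 := Finset.le_sup (f := Int.natAbs) hi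
      have h2 := Finset.le_sup (f := Int.natAbs) hj
      have h3 : (i - j).natAbs = (2 * I.sup Int.natAbs + 1) * t.natAbs := by
        rw [← hji, add_sub_cancel_left, Int.natAbs_mul, Int.natAbs_natCast]
      have h4 : 1 ≤ t.natAbs := Int.natAbs_pos.mpr ht
      have h5 : 2 * I.sup Int.natAbs + 1 ≤ (i - j).natAbs := h3 ▸ Nat.le_mul_of_pos_right _ h4
      omega
    have hinvN : seqShift (N * t) ⁻¹' A = A := by
      rw [← seqShift_iterate]
      exact Function.IsFixedPt.preimage_iterate hinv N
    set B : Set (ℤ → ℝ) := cylinder I S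
    have hBm : MeasurableSet B := hS.cylinder I
    have hd : μ.real (B ∆ A) ≤ ε := ENNReal.toReal_le_of_le_ofReal hε.le hBA.le
    have hmix : μ.real (B ∩ seqShift (N * t) ⁻¹' B) = μ.real B * μ.real B := by
      simp only [Measure.real, ← ENNReal.toReal_mul]
      rw [measure_cylinder_inter_seqShift hS hN]
    have hd2 : μ.real (seqShift (N * t) ⁻¹' (B ∆ A)) = μ.real (B ∆ A) := by
      simp only [Measure.real]
      rw [(measurePreserving_seqShift _).measure_preimage (hBm.symmDiff hA).nullMeasurableSet]
    have h1 := abs_measureReal_sub_le_measureReal_symmDiff (μ := μ) hBm.nullMeasurableSet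
      hA.nullMeasurableSet
    have h2 := abs_measureReal_sub_le_measureReal_symmDiff (μ := μ)
      (hBm.inter (measurable_seqShift (N * t) hBm)).nullMeasurableSet hA.nullMeasurableSet
    have h3 : μ.real ((B ∩ seqShift (N * t) ⁻¹' B) ∆ A) ≤ 2 * ε := by
      have hsub : (B ∩ seqShift (N * t) ⁻¹' B) ∆ A ⊆ (B ∆ A) ∪ seqShift (N * t) ⁻¹' (B ∆ A) := by
        intro z hz
        have e : seqShift (N * t) z ∈ A ↔ z ∈ A := by
          conv_rhs => rw [← hinvN]
          rfl
        simp only [Set.mem_symmDiff, Set.mem_inter_iff, Set.mem_preimage, Set.mem_union] at hz ⊢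
        tauto
      calc μ.real ((B ∩ seqShift (N * t) ⁻¹' B) ∆ A)
          ≤ μ.real ((B ∆ A) ∪ seqShift (N * t) ⁻¹' (B ∆ A)) := measureReal_mono hsub
        _ ≤ _ := measureReal_union_le _ _
        _ ≤ 2 * ε := by rw [hd2]; linarith
    rw [hmix] at h2
    have hq0 : 0 ≤ μ.real B := measureReal_nonneg
    have hq1 : μ.real B ≤ 1 := measureReal_le_one
    have hp0 : 0 ≤ μ.real A := measureReal_nonneg
    have hp1 : μ.real A ≤ 1 := measureReal_le_one
    have h1' := abs_le.mp (h1.trans hd)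
    have h2' := abs_le.mp (h2.trans h3)
    rw [abs_le]
    constructor <;> nlinarith
  have hz : μ.real A - μ.real A * μ.real A = 0 := by
    by_contra hne
    have hpos := abs_pos.mpr hne
    have := key (|μ.real A - μ.real A * μ.real A| / 8) (by positivity)
    linarith
  rw [eventuallyConst_set']
  have hz' : μ.real A = 0 ∨ μ.real A = 1 := by
    have : μ.real A * (1 - μ.real A) = 0 := by linarith
    rcases mul_eq_zero.mp this with h | h
    · exact Or.inl h
    · exact Or.inr (by linarith)
  rcases hz' with h | h
  · left
    exact ae_eq_empty.mpr ((measureReal_eq_zero_iff).mp h)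
  · right
    rw [ae_eq_univ, ← prob_compl_eq_one_iff hA.compl, compl_compl]
    simpa [Measure.real, ENNReal.toReal_eq_one_iff] using h

end Shift

/-! ### One step of the log-volatility recursion -/

section Recursion

/-- The fixed point `α / (1 - β)` of the recursion for the log-volatility without shocks. -/
noncomputable def baseLevel (θ : Param) : ℝ := θ.α / (1 - θ.β)

/-- One step of the recursion for the log-volatility given the observation `x`. -/
noncomputable def logStep (x : ℝ) (θ : Param) (l : ℝ) : ℝ :=
  θ.α + θ.β * l + (θ.γ * x + θ.δ * |x|) * Real.exp (-l / 2)

/-- The random Lipschitz coefficient `‖λ₀‖_K` as a function of the observation. -/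
noncomputable def lipSup (K : Set Param) (x : ℝ) : ℝ := supNorm K (lipBound K x)

lemma shock_nonneg {g d : ℝ} (h : |g| ≤ d) (x : ℝ) : 0 ≤ g * x + d * |x| := by
  have h1 : |g * x| ≤ d * |x| := by
    rw [abs_mul]
    exact mul_le_mul_of_nonneg_right h (abs_nonneg x)
  linarith [neg_abs_le (g * x)]

lemma continuous_param (i : Fin 4) : Continuous fun θ : Param => θ i := by fun_prop

lemma continuous_logStep (x : ℝ) : Continuous fun p : Param × ℝ => logStep x p.1 p.2 := by
  unfold logStep
  fun_prop

lemma continuous_lipBound (K : Set Param) :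
    Continuous fun p : ℝ × Param => lipBound K p.1 p.2 := by
  unfold lipBound
  fun_prop

lemma continuousOn_baseLevel : ContinuousOn baseLevel paramSpace := by
  refine ContinuousOn.div (continuous_param 0).continuousOn
    (continuous_const.sub (continuous_param 1)).continuousOn fun θ hθ => ?_
  have := hθ.2.1
  simp only [Param.β] at this
  exact (sub_pos.mpr this).ne'

variable {K : Set Param} (hK : IsCompact K) (hKΘ : K ⊆ paramSpace)

include hK hKΘ

lemma lowerBound_le_baseLevel {θ : Param} (hθ : θ ∈ K) : lowerBound K ≤ baseLevel θ := by
  have hb := hK.bddBelow_image (continuousOn_baseLevel.mono hKΘ)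
  refine ciInf_le (f := fun θ : K => baseLevel θ) ?_ (⟨θ, hθ⟩ : K)
  rwa [Set.image_eq_range] at hb

lemma exists_abs_baseLevel_le : ∃ C, ∀ θ ∈ K, |baseLevel θ| ≤ C :=
  hK.exists_bound_of_continuousOn (continuousOn_baseLevel.mono hKΘ)

lemma exists_beta_le : ∃ B, 0 ≤ B ∧ B < 1 ∧ ∀ θ ∈ K, θ.β ≤ B := by
  rcases K.eq_empty_or_nonempty with rfl | hne
  · exact ⟨0, le_rfl, one_pos, by simp⟩
  · obtain ⟨θ, hθ, hmax⟩ := hK.exists_isMaxOn hne (continuous_param 1).continuousOn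
    exact ⟨θ.β, (hKΘ hθ).1, (hKΘ hθ).2.1, fun η hη => hmax hη⟩

omit hKΘ in
lemma bddAbove_lipBound (x : ℝ) : BddAbove (Set.range fun θ : K => |lipBound K x θ|) := by
  have h : Continuous fun θ : Param => |lipBound K x θ| :=
    ((continuous_lipBound K).comp (Continuous.prodMk_right x)).abs
  have hb := hK.bddAbove_image h.continuousOn
  rwa [Set.image_eq_range] at hb

omit hKΘ in
lemma lipBound_le_lipSup (x : ℝ) {θ : Param} (hθ : θ ∈ K) : lipBound K x θ ≤ lipSup K x :=
  (le_abs_self _).trans (le_ciSup (bddAbove_lipBound hK x) (⟨θ, hθ⟩ : K))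

omit hK hKΘ in
lemma lipSup_nonneg (x : ℝ) : 0 ≤ lipSup K x := Real.iSup_nonneg fun _ => abs_nonneg _

omit hKΘ in
-- The supremum is uncountable, but a supremum of functions continuous in x is lower semicontinuous,
-- hence Borel.
lemma measurable_lipSup (hne : K.Nonempty) : Measurable (lipSup K) := by
  have : Nonempty K := hne.to_subtype
  have h : LowerSemicontinuous fun x => ⨆ θ : K, |lipBound K x θ| := by
    refine lowerSemicontinuous_ciSup (bddAbove_lipBound hK) fun θ => ?_
    exact (((continuous_lipBound K).comp (Continuous.prodMk_left (θ : Param))).abs).lowerSemicontinuous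
  exact h.measurable

omit hKΘ in
/-- The shock is controlled by the Lipschitz coefficient. -/
lemma shock_le_lipSup (x : ℝ) {θ : Param} (hθ : θ ∈ K) :
    (θ.γ * x + θ.δ * |x|) * Real.exp (-lowerBound K / 2) ≤ 4 * lipSup K x := by
  have h := lipBound_le_lipSup hK x hθ
  -- Both branches of the maximum are needed: half the scaled shock is at most `lipSup` + β, and β
  -- is at most `lipSup`.
  have h1 := (le_max_left _ _).trans h
  have h2 := (le_max_right _ _).trans h
  linarith

/-- The recursion for the log-volatility is Lipschitz above the lower bound of the volatilities. -/
lemma abs_logStep_sub_le (x : ℝ) {θ : Param} (hθ : θ ∈ K) {ε u v : ℝ} (hε : 0 ≤ ε)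
    (hu : lowerBound K - ε ≤ u) (hv : lowerBound K - ε ≤ v) :
    |logStep x θ u - logStep x θ v| ≤ Real.exp ε * lipSup K x * |u - v| := by
  wlog huv : v ≤ u generalizing u v
  · rw [abs_sub_comm, abs_sub_comm u]
    exact this hv hu (le_of_not_ge huv)
  obtain ⟨hβ0, -, hγδ⟩ := hKΘ hθ
  have hc := shock_nonneg hγδ x
  have h := lipBound_le_lipSup hK x hθ
  have h1 : θ.β ≤ lipSup K x := (le_max_left _ _).trans h
  have h2 := (le_max_right _ _).trans h
  set c := θ.γ * x + θ.δ * |x|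
  set Λ := lipSup K x
  -- The slack ε is there for estimated volatilities, which may start below `lowerBound K`. It costs
  -- a factor q in the bound on exp(-v / 2).
  set q := Real.exp (ε / 2) with hq
  have hq1 : 1 ≤ q := Real.one_le_exp (by linarith)
  have hqq : Real.exp ε = q * q := by rw [hq, ← Real.exp_add]; congr 1; ring
  have hΛ : 0 ≤ Λ := hβ0.trans h1
  have hd : 0 ≤ u - v := sub_nonneg.mpr huv
  have he0 : Real.exp (-u / 2) ≤ Real.exp (-v / 2) := Real.exp_le_exp.mpr (by linarith)
  have he1 : Real.exp (-v / 2) - Real.exp (-u / 2) ≤ Real.exp (-v / 2) * ((u - v) / 2) := by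
    have e : Real.exp (-u / 2) = Real.exp (-v / 2) * Real.exp (-(u - v) / 2) := by
      rw [← Real.exp_add]; congr 1; ring
    have := Real.add_one_le_exp (-(u - v) / 2)
    rw [e]
    nlinarith [Real.exp_pos (-v / 2)]
  have he2 : Real.exp (-v / 2) ≤ Real.exp (-lowerBound K / 2) * q := by
    rw [hq, ← Real.exp_add]
    exact Real.exp_le_exp.mpr (by linarith)
  have hdiff : logStep x θ u - logStep x θ v
      = θ.β * (u - v) - c * (Real.exp (-v / 2) - Real.exp (-u / 2)) := by
    simp only [logStep]; ring
  have hupper : c * (Real.exp (-v / 2) - Real.exp (-u / 2))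
      ≤ 2⁻¹ * Real.exp (-lowerBound K / 2) * c * q * (u - v) := by
    calc c * (Real.exp (-v / 2) - Real.exp (-u / 2))
        ≤ c * ((Real.exp (-lowerBound K / 2) * q) * ((u - v) / 2)) := by
          refine mul_le_mul_of_nonneg_left (he1.trans ?_) hc
          exact mul_le_mul_of_nonneg_right he2 (by linarith)
      _ = _ := by ring
  -- From y ≤ Λ + β and β ≤ Λ one gets y q - β ≤ (2q - 1) Λ ≤ q² Λ, the last step being (q - 1)² ≥
  -- 0.
  have hcoef : 2⁻¹ * Real.exp (-lowerBound K / 2) * c * q - θ.β ≤ q * q * Λ := by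
    set y := 2⁻¹ * Real.exp (-lowerBound K / 2) * c
    have h3 : y * q ≤ (Λ + θ.β) * q := mul_le_mul_of_nonneg_right (by linarith) (by linarith)
    have h4 : (q - 1) * θ.β ≤ (q - 1) * Λ := mul_le_mul_of_nonneg_left h1 (by linarith)
    nlinarith [mul_nonneg (sq_nonneg (q - 1)) hΛ]
  have hβΛ : θ.β ≤ q * q * Λ := h1.trans (le_mul_of_one_le_left hΛ (by nlinarith))
  rw [hdiff, abs_of_nonneg hd, hqq, abs_le]
  constructor
  · nlinarith [mul_le_mul_of_nonneg_right hcoef hd]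
  · nlinarith [mul_le_mul_of_nonneg_right hβΛ hd,
      mul_nonneg hc (sub_nonneg.mpr he0)]

omit hK in
-- Shocks are nonnegative since δ ≥ |γ|, so the step dominates the affine map with fixed point
-- `baseLevel`. Orbits starting above that level stay above it, and a deficit below it shrinks at
-- least by the factor β.
lemma baseLevel_le_logStep (x : ℝ) {θ : Param} (hθ : θ ∈ K) (l : ℝ) :
    θ.β * (l - baseLevel θ) ≤ logStep x θ l - baseLevel θ := by
  obtain ⟨-, hβ1, hγδ⟩ := hKΘ hθ
  have hb : baseLevel θ * (1 - θ.β) = θ.α := div_mul_cancel₀ _ (sub_pos.mpr hβ1).ne'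
  have hc := mul_nonneg (shock_nonneg hγδ x) (Real.exp_pos (-l / 2)).le
  simp only [logStep]
  linarith

end Recursion

/-! ### The recursion started in the infinite past -/

section Stationary

/-- The log-volatility at time `t` computed from the data `x` by running the recursion for `n`
steps from the level `α / (1 - β)`. -/
noncomputable def backIter (x : ℤ → ℝ) (θ : Param) : ℕ → ℤ → ℝ
  | 0, _ => baseLevel θ
  | n + 1, t => logStep (x (t - 1)) θ (backIter x θ n (t - 1))

/-- The log-volatility at time `t` computed from the infinite past of `x`. -/
noncomputable def statLog (x : ℤ → ℝ) (θ : Param) (t : ℤ) : ℝ :=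
  limsup (fun n => backIter x θ n t) atTop

/-- The product of the Lipschitz coefficients over the `n` observations preceding `t`. -/
noncomputable def backProd (K : Set Param) (x : ℤ → ℝ) (t : ℤ) (n : ℕ) : ℝ :=
  ∏ j ∈ Finset.range n, lipSup K (x (t - 1 - j))

/-- The product of the Lipschitz coefficients of the first `n` observations. -/
noncomputable def forwProd (K : Set Param) (x : ℤ → ℝ) (n : ℕ) : ℝ :=
  ∏ j ∈ Finset.range n, lipSup K (x j)

/-- The data along which the recursions for the volatility are contractive on average. -/
structure IsContractive (K : Set Param) (x : ℤ → ℝ) : Prop where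
  summable_backProd : ∀ t, Summable fun n => backProd K x t n
  tendsto_forwProd : Tendsto (forwProd K x) atTop (𝓝 0)

lemma backProd_nonneg (K : Set Param) (x : ℤ → ℝ) (t : ℤ) (n : ℕ) : 0 ≤ backProd K x t n :=
  Finset.prod_nonneg fun _ _ => lipSup_nonneg _

lemma backProd_succ (K : Set Param) (x : ℤ → ℝ) (t : ℤ) (n : ℕ) :
    backProd K x t (n + 1) = lipSup K (x (t - 1)) * backProd K x (t - 1) n := by
  rw [backProd, Finset.prod_range_succ', mul_comm, backProd]
  congr 1
  · simp
  · refine Finset.prod_congr rfl fun j _ => ?_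
    congr 2
    push_cast
    ring

variable {K : Set Param} (hK : IsCompact K) (hKΘ : K ⊆ paramSpace)

include hKΘ in
lemma baseLevel_le_backIter (x : ℤ → ℝ) {θ : Param} (hθ : θ ∈ K) (n : ℕ) (t : ℤ) :
    baseLevel θ ≤ backIter x θ n t := by
  induction n generalizing t with
  | zero => exact le_rfl
  | succ n ih =>
    have h := baseLevel_le_logStep hKΘ (x (t - 1)) hθ (backIter x θ n (t - 1))
    have h0 := mul_nonneg (hKΘ hθ).1 (sub_nonneg.mpr (ih (t - 1)))
    rw [backIter]
    linarith

include hK hKΘ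

/-- Starting at the shock-free fixed point makes the first increment a pure shock, bounded by
`shock_le_lipSup`, and keeps every iterate above `lowerBound K`. Each further step then multiplies
the increment by one Lipschitz coefficient, without slack. -/
lemma abs_backIter_sub_le (x : ℤ → ℝ) {θ : Param} (hθ : θ ∈ K) (n : ℕ) (t : ℤ) :
    |backIter x θ (n + 1) t - backIter x θ n t| ≤ 4 * backProd K x t (n + 1) := by
  have hm := lowerBound_le_baseLevel hK hKΘ hθ
  induction n generalizing t with
  | zero =>
    have hβ1 := (hKΘ hθ).2.1
    have hb : baseLevel θ * (1 - θ.β) = θ.α := div_mul_cancel₀ _ (sub_pos.mpr hβ1).ne'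
    have hc := shock_nonneg (hKΘ hθ).2.2 (x (t - 1))
    have e : backIter x θ (0 + 1) t - backIter x θ 0 t
        = (θ.γ * x (t - 1) + θ.δ * |x (t - 1)|) * Real.exp (-baseLevel θ / 2) := by
      simp only [backIter, logStep]
      linarith
    rw [e, abs_of_nonneg (mul_nonneg hc (Real.exp_pos _).le)]
    refine le_trans ?_ ((shock_le_lipSup hK (x (t - 1)) hθ).trans_eq ?_)
    · exact mul_le_mul_of_nonneg_left (Real.exp_le_exp.mpr (by linarith)) hc
    · simp [backProd]
  | succ n ih =>
    have h := abs_logStep_sub_le hK hKΘ (x (t - 1)) hθ le_rfl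
      (u := backIter x θ (n + 1) (t - 1)) (v := backIter x θ n (t - 1))
      (by linarith [baseLevel_le_backIter hKΘ x hθ (n + 1) (t - 1)])
      (by linarith [baseLevel_le_backIter hKΘ x hθ n (t - 1)])
    rw [Real.exp_zero, one_mul] at h
    calc |backIter x θ (n + 1 + 1) t - backIter x θ (n + 1) t|
        ≤ lipSup K (x (t - 1)) * |backIter x θ (n + 1) (t - 1) - backIter x θ n (t - 1)| := h
      _ ≤ lipSup K (x (t - 1)) * (4 * backProd K x (t - 1) (n + 1)) :=
          mul_le_mul_of_nonneg_left (ih (t - 1)) (lipSup_nonneg _)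
      _ = 4 * backProd K x t (n + 1 + 1) := by rw [backProd_succ K x t]; ring

variable {x : ℤ → ℝ} (hx : IsContractive K x)

include hx

omit hK hKΘ in
lemma summable_backBound (t : ℤ) : Summable fun n => 4 * backProd K x t (n + 1) :=
  ((summable_nat_add_iff 1).mpr (hx.summable_backProd t)).mul_left 4

lemma tendsto_backIter {θ : Param} (hθ : θ ∈ K) (t : ℤ) :
    Tendsto (fun n => backIter x θ n t) atTop (𝓝 (statLog x θ t)) := by
  have hc : CauchySeq fun n => backIter x θ n t := by
    refine cauchySeq_of_dist_le_of_summable _ (fun n => ?_) (summable_backBound hx t)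
    rw [dist_comm, Real.dist_eq]
    exact abs_backIter_sub_le hK hKΘ x hθ n t
  obtain ⟨l, hl⟩ := cauchySeq_tendsto_of_complete hc
  rw [statLog, hl.limsup_eq]
  exact hl

lemma abs_backIter_sub_statLog_le {θ : Param} (hθ : θ ∈ K) (n : ℕ) (t : ℤ) :
    |backIter x θ n t - statLog x θ t| ≤ ∑' k, 4 * backProd K x t (n + k + 1) := by
  refine dist_le_tsum_of_dist_le_of_tendsto (fun n => 4 * backProd K x t (n + 1)) (fun n => ?_)
    (summable_backBound hx t) (tendsto_backIter hK hKΘ hx hθ t) n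
  rw [dist_comm, Real.dist_eq]
  exact abs_backIter_sub_le hK hKΘ x hθ n t

lemma baseLevel_le_statLog {θ : Param} (hθ : θ ∈ K) (t : ℤ) : baseLevel θ ≤ statLog x θ t :=
  ge_of_tendsto' (tendsto_backIter hK hKΘ hx hθ t) fun n => baseLevel_le_backIter hKΘ x hθ n t

lemma lowerBound_le_statLog {θ : Param} (hθ : θ ∈ K) (t : ℤ) : lowerBound K ≤ statLog x θ t :=
  (lowerBound_le_baseLevel hK hKΘ hθ).trans (baseLevel_le_statLog hK hKΘ hx hθ t)

lemma statLog_eq_logStep {θ : Param} (hθ : θ ∈ K) (t : ℤ) :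
    statLog x θ t = logStep (x (t - 1)) θ (statLog x θ (t - 1)) := by
  have h1 := (tendsto_backIter hK hKΘ hx hθ t).comp (tendsto_add_atTop_nat 1)
  have hcont : Continuous (logStep (x (t - 1)) θ) :=
    (continuous_logStep (x (t - 1))).comp (Continuous.prodMk_right θ)
  exact tendsto_nhds_unique h1
    ((hcont.tendsto _).comp (tendsto_backIter hK hKΘ hx hθ (t - 1)))

omit hK hx in
lemma continuousOn_backIter (n : ℕ) (t : ℤ) : ContinuousOn (fun θ => backIter x θ n t) K := by
  induction n generalizing t with
  | zero => exact continuousOn_baseLevel.mono hKΘ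
  | succ n ih =>
    exact (continuous_logStep (x (t - 1))).comp_continuousOn (continuousOn_id.prodMk (ih (t - 1)))

/-- The tail bound on the increments does not depend on θ, so this is a uniform limit of continuous
functions. -/
lemma continuousOn_statLog (t : ℤ) : ContinuousOn (fun θ => statLog x θ t) K := by
  have hlim : Tendsto (fun n => ∑' k, 4 * backProd K x t (n + k + 1)) atTop (𝓝 0) := by
    have := tendsto_sum_nat_add fun n => 4 * backProd K x t (n + 1)
    refine this.congr fun n => tsum_congr fun k => ?_
    rw [add_comm k n]
  have hu : TendstoUniformlyOn (fun n θ => backIter x θ n t) (fun θ => statLog x θ t) atTop K := by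
    rw [Metric.tendstoUniformlyOn_iff]
    intro ε hε
    filter_upwards [hlim.eventually_lt_const hε] with n hn θ hθ
    rw [dist_comm, Real.dist_eq]
    exact (abs_backIter_sub_statLog_le hK hKΘ hx hθ n t).trans_lt hn
  exact hu.continuousOn (Frequently.of_forall fun n => continuousOn_backIter hKΘ n t)

end Stationary

/-! ### Forgetting the initial value -/

section Estimate

lemma log_hHat_succ (s : ℝ) (x : ℤ → ℝ) (θ : Param) (t : ℕ) :
    Real.log (hHat s x θ (t + 1)) = logStep (x t) θ (Real.log (hHat s x θ t)) := by
  rw [hHat, Real.log_exp, logStep, neg_div]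

lemma hHat_pos {s : ℝ} (hs : 0 < s) (x : ℤ → ℝ) (θ : Param) (t : ℕ) : 0 < hHat s x θ t := by
  cases t with
  | zero => exact hs
  | succ t => exact Real.exp_pos _

lemma continuous_log_hHat (s : ℝ) (x : ℤ → ℝ) (t : ℕ) :
    Continuous fun θ => Real.log (hHat s x θ t) := by
  induction t with
  | zero => simpa only [hHat] using continuous_const
  | succ t ih =>
    simp_rw [log_hHat_succ]
    exact (continuous_logStep (x t)).comp (continuous_id'.prodMk ih)

/-- The likelihood contributions in terms of the log-volatility. -/
lemma logLik_eq {s : ℝ} (hs : 0 < s) (x : ℤ → ℝ) (n : ℕ) (θ : Param) :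
    logLik s x n θ = -(1 / 2) * ∑ t ∈ Finset.Icc 1 n,
      ((x t) ^ 2 * Real.exp (-Real.log (hHat s x θ t)) + Real.log (hHat s x θ t)) := by
  rw [logLik]
  congr 1
  refine Finset.sum_congr rfl fun t _ => ?_
  rw [Real.exp_neg, Real.exp_log (hHat_pos hs x θ t), div_eq_mul_inv]

lemma exists_isQMLE {K : Set Param} (hK : IsCompact K) (hne : K.Nonempty) {s : ℝ} (hs : 0 < s)
    (x : ℤ → ℝ) (n : ℕ) : ∃ θ, IsQMLE s x K n θ := by
  have hc : Continuous (logLik s x n) := by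
    simp_rw [funext (logLik_eq hs x n)]
    refine continuous_const.mul (continuous_finsetSum _ fun t _ => ?_)
    have := continuous_log_hHat s x t
    fun_prop
  obtain ⟨θ, hθ, h⟩ := hK.exists_isMaxOn hne hc.continuousOn
  exact ⟨θ, hθ, h⟩

/-- The estimated log-volatility approaches the stationary one uniformly in the parameter. -/
theorem exists_abs_log_hHat_sub_statLog_le {K : Set Param} (hK : IsCompact K)
    (hKΘ : K ⊆ paramSpace) {x : ℤ → ℝ} (hx : IsContractive K x) (s : ℝ) :
    ∃ E : ℕ → ℝ, Tendsto E atTop (𝓝 0) ∧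
      ∀ t : ℕ, ∀ θ ∈ K, |Real.log (hHat s x θ t) - statLog x θ t| ≤ E t := by
  obtain ⟨B, hB0, hB1, hB⟩ := exists_beta_le hK hKΘ
  obtain ⟨A, hA⟩ := exists_abs_baseLevel_le hK hKΘ
  obtain ⟨D, hD⟩ := hK.exists_bound_of_continuousOn (continuousOn_statLog hK hKΘ hx 0)
  set C := |Real.log s| + |A| with hC
  have hC0 : 0 ≤ C := by positivity
  -- An initial value below the base level leaves a deficit that decays like Bᵗ; C bounds it at time
  -- zero for all θ in K.
  have hlow : ∀ t : ℕ, ∀ θ ∈ K, lowerBound K - C * B ^ t ≤ Real.log (hHat s x θ t) := by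
    intro t θ hθ
    have h1 : -(C * B ^ t) ≤ Real.log (hHat s x θ t) - baseLevel θ := by
      induction t with
      | zero =>
        have h2 := (abs_le.mp ((hA θ hθ).trans (le_abs_self A))).2
        have h3 := neg_abs_le (Real.log s)
        simp only [hHat, pow_zero, mul_one, hC]
        linarith
      | succ t ih =>
        rw [log_hHat_succ]
        refine le_trans ?_ (baseLevel_le_logStep hKΘ _ hθ _)
        have h2 := mul_le_mul_of_nonneg_left ih (hKΘ hθ).1
        have h3 : θ.β * (C * B ^ t) ≤ B * (C * B ^ t) :=
          mul_le_mul_of_nonneg_right (hB θ hθ) (by positivity)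
        rw [pow_succ]
        linarith
    linarith [lowerBound_le_baseLevel hK hKΘ hθ]
  -- Step j contracts by `lipSup` up to the factor exp(C Bʲ). The exponents are summable, so the
  -- accumulated correction stays bounded and the forward product decides.
  have hmain : ∀ t : ℕ, ∀ θ ∈ K, |Real.log (hHat s x θ t) - statLog x θ t| ≤
      Real.exp (∑ j ∈ Finset.range t, C * B ^ j) * forwProd K x t * (|Real.log s| + D) := by
    intro t θ hθ
    induction t with
    | zero =>
      simp only [hHat, forwProd, Finset.range_zero, Finset.sum_empty, Finset.prod_empty,
        Real.exp_zero, one_mul, Nat.cast_zero]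
      exact (abs_sub _ _).trans (add_le_add le_rfl (hD θ hθ))
    | succ t ih =>
      have e : statLog x θ ((t + 1 : ℕ) : ℤ) = logStep (x t) θ (statLog x θ t) := by
        rw [statLog_eq_logStep hK hKΘ hx hθ]
        push_cast
        rw [add_sub_cancel_right]
      rw [log_hHat_succ, e]
      have hε : 0 ≤ C * B ^ t := by positivity
      refine (abs_logStep_sub_le hK hKΘ (x t) hθ hε (hlow t θ hθ) ?_).trans ?_
      · linarith [lowerBound_le_statLog hK hKΘ hx hθ t]
      · refine (mul_le_mul_of_nonneg_left ih
          (mul_nonneg (Real.exp_pos _).le (lipSup_nonneg _))).trans_eq ?_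
        rw [Finset.sum_range_succ, Real.exp_add, forwProd, forwProd, Finset.prod_range_succ]
        ring
  refine ⟨fun t => Real.exp (C * (1 - B)⁻¹) * forwProd K x t * (|Real.log s| + |D|), ?_,
    fun t θ hθ => (hmain t θ hθ).trans ?_⟩
  · simpa using (hx.tendsto_forwProd.const_mul (Real.exp (C * (1 - B)⁻¹))).mul_const
      (|Real.log s| + |D|)
  · have hp : 0 ≤ forwProd K x t := Finset.prod_nonneg fun _ _ => lipSup_nonneg _
    have hsum : ∑ j ∈ Finset.range t, C * B ^ j ≤ C * (1 - B)⁻¹ := by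
      rw [← Finset.mul_sum, ← tsum_geometric_of_lt_one hB0 hB1]
      exact mul_le_mul_of_nonneg_left ((summable_geometric_of_lt_one hB0 hB1).sum_le_tsum _
        fun j _ => pow_nonneg hB0 j) hC0
    have h1 := Real.exp_le_exp.mpr hsum
    have h2 := le_abs_self D
    refine mul_le_mul (mul_le_mul_of_nonneg_right h1 hp) (by linarith) ?_ (by positivity)
    have := (abs_nonneg _).trans (hD θ hθ)
    positivity

end Estimate

/-! ### The EGARCH process as a function of its innovations -/

section Canonical

/-- The discounted sum of the past shocks `∑ βᵏ (γ z_{t-1-k} + δ |z_{t-1-k}|)`. -/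
noncomputable def shockSum (θ : Param) (z : ℤ → ℝ) (t : ℤ) : ℝ≥0∞ :=
  ∑' k : ℕ, ENNReal.ofReal (θ.β ^ k * (θ.γ * z (t - 1 - k) + θ.δ * |z (t - 1 - k)|))

/-- The stationary log-volatility `log σ_t²` as a function of the innovations. -/
noncomputable def logVol (θ : Param) (z : ℤ → ℝ) (t : ℤ) : ℝ :=
  baseLevel θ + (shockSum θ z t).toReal

/-- The stationary EGARCH process as a function of the innovations. -/
noncomputable def egarch (θ : Param) (z : ℤ → ℝ) (t : ℤ) : ℝ :=
  Real.exp (logVol θ z t / 2) * z t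

lemma shockSum_seqShift (θ : Param) (z : ℤ → ℝ) (s t : ℤ) :
    shockSum θ (seqShift s z) t = shockSum θ z (t + s) := by
  have e : ∀ k : ℕ, t - 1 - k + s = t + s - 1 - k := fun k => by ring
  simp only [shockSum, seqShift, e]

lemma logVol_seqShift (θ : Param) (z : ℤ → ℝ) (s t : ℤ) :
    logVol θ (seqShift s z) t = logVol θ z (t + s) := by
  rw [logVol, logVol, shockSum_seqShift]

lemma egarch_seqShift (θ : Param) (z : ℤ → ℝ) (s t : ℤ) :
    egarch θ (seqShift s z) t = egarch θ z (t + s) := by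
  rw [egarch, egarch, logVol_seqShift, seqShift]

lemma measurable_shockSum (θ : Param) (t : ℤ) : Measurable fun z => shockSum θ z t := by
  unfold shockSum
  fun_prop

lemma measurable_logVol (θ : Param) (t : ℤ) : Measurable fun z => logVol θ z t :=
  (measurable_shockSum θ t).ennreal_toReal.const_add _

lemma measurable_egarch (θ : Param) (t : ℤ) : Measurable fun z => egarch θ z t :=
  ((measurable_logVol θ t).div_const 2).exp.mul (measurable_pi_apply t)

lemma baseLevel_le_logVol (θ : Param) (z : ℤ → ℝ) (t : ℤ) : baseLevel θ ≤ logVol θ z t :=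
  le_add_of_nonneg_right ENNReal.toReal_nonneg

lemma logVol_congr (θ : Param) {z w : ℤ → ℝ} {t : ℤ} (h : ∀ k < t, z k = w k) :
    logVol θ z t = logVol θ w t := by
  have e : ∀ k : ℕ, z (t - 1 - k) = w (t - 1 - k) := fun k => h _ (by omega)
  simp only [logVol, shockSum, e]

variable {θ : Param} (hθ : θ ∈ paramSpace)

include hθ

lemma shockSum_succ (z : ℤ → ℝ) (t : ℤ) :
    shockSum θ z (t + 1) = ENNReal.ofReal (θ.γ * z t + θ.δ * |z t|)
      + ENNReal.ofReal θ.β * shockSum θ z t := by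
  rw [shockSum, tsum_eq_zero_add' ENNReal.summable, shockSum, ← ENNReal.tsum_mul_left]
  congr 1
  · simp
  · refine tsum_congr fun k => ?_
    have e : t + 1 - 1 - ((k + 1 : ℕ) : ℤ) = t - 1 - k := by push_cast; ring
    rw [e, ← ENNReal.ofReal_mul hθ.1, pow_succ]
    congr 1
    ring

lemma logVol_succ {z : ℤ → ℝ} {t : ℤ} (h : shockSum θ z t ≠ ∞) :
    logVol θ z (t + 1) = θ.α + θ.β * logVol θ z t + θ.γ * z t + θ.δ * |z t| := by
  have hb : baseLevel θ * (1 - θ.β) = θ.α := div_mul_cancel₀ _ (sub_pos.mpr hθ.2.1).ne'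
  rw [logVol, shockSum_succ hθ, ENNReal.toReal_add ENNReal.ofReal_ne_top
    (ENNReal.mul_ne_top ENNReal.ofReal_ne_top h), ENNReal.toReal_mul, ENNReal.toReal_ofReal hθ.1,
    ENNReal.toReal_ofReal (shock_nonneg hθ.2.2 _), logVol]
  linarith

/-- Dividing the observation by the true volatility gives back the innovation, so at the true
parameter the data recursion and the model recursion coincide. -/
lemma logStep_egarch {z : ℤ → ℝ} {t : ℤ} (h : shockSum θ z t ≠ ∞) :
    logStep (egarch θ z t) θ (logVol θ z t) = logVol θ z (t + 1) := by
  have e : Real.exp (logVol θ z t / 2) * Real.exp (-logVol θ z t / 2) = 1 := by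
    rw [← Real.exp_add, neg_div, add_neg_cancel, Real.exp_zero]
  rw [logVol_succ hθ h, logStep, egarch, abs_mul, abs_of_pos (Real.exp_pos _)]
  linear_combination (θ.γ * z t + θ.δ * |z t|) * e

variable {ν : Measure ℝ} [IsProbabilityMeasure ν] (hν : Integrable (fun y => y) ν)

include hν

/-- By Tonelli this is a geometric series times the mean of one shock, so a first moment of the
innovation suffices. -/
lemma lintegral_shockSum_ne_top (t : ℤ) : ∫⁻ z, shockSum θ z t ∂(iidLaw ν) ≠ ∞ := by
  have h1 : ∀ k : ℤ, ∫⁻ z, ENNReal.ofReal (θ.γ * z k + θ.δ * |z k|) ∂(iidLaw ν)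
      = ∫⁻ y, ENNReal.ofReal (θ.γ * y + θ.δ * |y|) ∂ν := fun k =>
    (measurePreserving_eval_infinitePi (fun _ : ℤ => ν) k).lintegral_comp
      (f := fun y => ENNReal.ofReal (θ.γ * y + θ.δ * |y|)) (by fun_prop)
  have h2 : ∫⁻ y, ENNReal.ofReal (θ.γ * y + θ.δ * |y|) ∂ν ≠ ∞ :=
    ((hν.const_mul θ.γ).add (hν.abs.const_mul θ.δ)).lintegral_lt_top.ne
  simp only [shockSum]
  rw [lintegral_tsum fun k => by fun_prop]
  have h3 : ∀ k : ℕ, ∫⁻ z, ENNReal.ofReal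
      (θ.β ^ k * (θ.γ * z (t - 1 - k) + θ.δ * |z (t - 1 - k)|)) ∂(iidLaw ν)
      = ENNReal.ofReal θ.β ^ k * ∫⁻ y, ENNReal.ofReal (θ.γ * y + θ.δ * |y|) ∂ν := by
    intro k
    rw [← h1 (t - 1 - k), ← lintegral_const_mul _ (by fun_prop)]
    refine lintegral_congr fun z => ?_
    rw [ENNReal.ofReal_mul (pow_nonneg hθ.1 k), ENNReal.ofReal_pow hθ.1]
  simp_rw [h3]
  rw [ENNReal.tsum_mul_right, ENNReal.tsum_geometric]
  refine ENNReal.mul_ne_top (ENNReal.inv_ne_top.mpr ?_) h2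
  exact (tsub_pos_of_lt (ENNReal.ofReal_lt_one.mpr hθ.2.1)).ne'

lemma ae_shockSum_ne_top : ∀ᵐ z ∂(iidLaw ν), ∀ t, shockSum θ z t ≠ ∞ := by
  rw [ae_all_iff]
  intro t
  filter_upwards [ae_lt_top (measurable_shockSum θ t) (lintegral_shockSum_ne_top hθ hν t)]
    with z hz using hz.ne

lemma integrable_logVol (t : ℤ) : Integrable (fun z => logVol θ z t) (iidLaw ν) :=
  (integrable_const _).add (integrable_toReal_of_lintegral_ne_top
    (measurable_shockSum θ t).aemeasurable (lintegral_shockSum_ne_top hθ hν t))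

end Canonical

/-! ### Uniqueness of the stationary solution -/

section Representation

variable {Ω Ω' : Type*} [MeasurableSpace Ω] [MeasurableSpace Ω'] {P : Measure Ω} {Q : Measure Ω'}

/-- Identically distributed random variables, scaled by a null sequence, tend to zero in
probability. -/
lemma tendsto_measure_le_abs_mul [IsFiniteMeasure Q] {Y : ℕ → Ω → ℝ} {Y' : Ω' → ℝ}
    (hY : ∀ n, IdentDistrib (Y n) Y' P Q) {b : ℕ → ℝ} (hb : Tendsto b atTop (𝓝 0)) {ε : ℝ}
    (hε : 0 < ε) : Tendsto (fun n => P {ω | ε ≤ |b n * Y n ω|}) atTop (𝓝 0) := by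
  have h1 : TendstoInMeasure Q (fun n ω => b n * Y' ω) atTop fun _ => (0 : ℝ) := by
    refine tendstoInMeasure_of_tendsto_ae (fun n => ?_) (ae_of_all _ fun ω => ?_)
    · exact ((hY 0).aemeasurable_snd.const_mul (b n)).aestronglyMeasurable
    · simpa using hb.mul_const (Y' ω)
  refine (tendstoInMeasure_iff_norm.mp h1 ε hε).congr fun n => ?_
  have hs : MeasurableSet {y : ℝ | ε ≤ |b n * y|} :=
    measurableSet_le measurable_const (by fun_prop)
  have := (hY n).measure_mem_eq hs
  simpa [sub_zero, Real.norm_eq_abs] using this.symm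

/-- A random variable which has the law of a sequence tending to zero almost surely vanishes. -/
lemma ae_eq_zero_of_tendsto [IsFiniteMeasure Q] {T : ℕ → Ω' → Ω'} {d : Ω' → ℝ}
    (hd : Measurable d) (hT : ∀ n, MeasurePreserving (T n) Q Q)
    (h : ∀ᵐ ω ∂Q, Tendsto (fun n => d (T n ω)) atTop (𝓝 0)) : d =ᵐ[Q] 0 := by
  have h1 : TendstoInMeasure Q (fun n ω => d (T n ω)) atTop fun _ => (0 : ℝ) :=
    tendstoInMeasure_of_tendsto_ae
      (fun n => (hd.comp (hT n).measurable).aestronglyMeasurable) h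
  have h2 : ∀ ε : ℝ, 0 < ε → ∀ᵐ ω ∂Q, |d ω| < ε := by
    intro ε hε
    have h3 := tendstoInMeasure_iff_norm.mp h1 ε hε
    have hs : MeasurableSet {ω | ε ≤ |d ω|} := measurableSet_le measurable_const hd.abs
    have h4 : ∀ n, Q {ω | ε ≤ ‖d (T n ω) - 0‖} = Q {ω | ε ≤ |d ω|} := fun n => by
      simpa [Real.norm_eq_abs] using (hT n).measure_preimage hs.nullMeasurableSet
    simp_rw [h4] at h3
    have h5 := tendsto_nhds_unique tendsto_const_nhds h3
    simpa [ae_iff, not_lt] using h5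
  have h6 : ∀ᵐ ω ∂Q, ∀ n : ℕ, |d ω| < 1 / ((n : ℝ) + 1) :=
    ae_all_iff.mpr fun n => h2 _ Nat.one_div_pos_of_nat
  filter_upwards [h6] with ω hω
  have := ge_of_tendsto' tendsto_one_div_add_atTop_nhds_zero_nat fun n => (hω n).le
  exact abs_nonpos_iff.mp this

variable {θ : Param} {Z X σ : ℤ → Ω → ℝ}

lemma map_innovations_eq (h : IsStationaryEGARCH P θ Z X σ) :
    P.map (fun ω k => Z k ω) = iidLaw (P.map (Z 0)) := by
  rw [h.indep.map_fun_eq_infinitePi_map h.measurable_Z]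
  congr 1
  funext k
  exact (h.identDistrib k).map_eq

lemma measurable_innovations (h : IsStationaryEGARCH P θ Z X σ) :
    Measurable fun ω (k : ℤ) => Z k ω := measurable_pi_lambda _ h.measurable_Z

variable [IsProbabilityMeasure P]

lemma isProbabilityMeasure_innovation (h : IsStationaryEGARCH P θ Z X σ) :
    IsProbabilityMeasure (P.map (Z 0)) :=
  Measure.isProbabilityMeasure_map (h.measurable_Z 0).aemeasurable

lemma integrable_innovation (h : IsStationaryEGARCH P θ Z X σ) :
    Integrable (fun y => y) (P.map (Z 0)) :=
  (integrable_map_measure aestronglyMeasurable_id (h.measurable_Z 0).aemeasurable).mpr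
    (h.memLp.integrable one_le_two)

/-- The volatility of a stationary EGARCH process is given by the causal representation. -/
lemma ae_log_sq_eq_logVol (h : IsStationaryEGARCH P θ Z X σ) (hθ : θ ∈ paramSpace) (t : ℤ) :
    ∀ᵐ ω ∂P, Real.log (σ t ω ^ 2) = logVol θ (fun k => Z k ω) t := by
  have := isProbabilityMeasure_innovation h
  have hmap := map_innovations_eq h
  have hZm := measurable_innovations h
  have hfin : ∀ᵐ ω ∂P, ∀ t, shockSum θ (fun k => Z k ω) t ≠ ∞ := by
    have h1 := ae_shockSum_ne_top hθ (integrable_innovation h)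
    rw [← hmap] at h1
    exact ae_of_ae_map hZm.aemeasurable h1
  -- The difference of two solutions loses the shocks and satisfies D_t = βⁿ D_{t-n}.
  set D : ℤ → Ω → ℝ := fun t ω => Real.log (σ t ω ^ 2) - logVol θ (fun k => Z k ω) t with hD
  have hrec : ∀ᵐ ω ∂P, ∀ t, D t ω = θ.β * D (t - 1) ω := by
    filter_upwards [ae_all_iff.mpr h.recursion, hfin] with ω h1 h2 t
    have h3 := logVol_succ hθ (h2 (t - 1))
    rw [sub_add_cancel] at h3
    simp only [hD, h1 t, h3]
    ring
  have hpow : ∀ᵐ ω ∂P, ∀ n : ℕ, D t ω = θ.β ^ n * D (t - n) ω := by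
    filter_upwards [hrec] with ω hω n
    induction n with
    | zero => simp
    | succ n ih =>
      rw [ih, hω (t - n), pow_succ]
      push_cast
      rw [mul_assoc, sub_sub]
  have hb : Tendsto (fun n : ℕ => θ.β ^ n) atTop (𝓝 0) :=
    tendsto_pow_atTop_nhds_zero_of_lt_one hθ.1 hθ.2.1
  have hU : ∀ n : ℕ, IdentDistrib (fun ω => Real.log (σ (t - n) ω ^ 2))
      (fun ω => Real.log (σ 0 ω ^ 2)) P P := fun n => by
    have h1 := (h.stationary (t - n)).comp (u := fun y => Real.log ((y 0).2 ^ 2))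
      (((measurable_pi_apply (0 : ℤ)).snd.pow_const 2).log)
    simpa [Function.comp_def] using h1
  have hV : ∀ n : ℕ, IdentDistrib (fun ω => logVol θ (fun k => Z k ω) (t - n))
      (fun z => logVol θ z 0) P (iidLaw (P.map (Z 0))) := fun n => by
    have h1 : IdentDistrib (fun ω k => Z k ω) (seqShift (-(t - n))) P (iidLaw (P.map (Z 0))) :=
      ⟨hZm.aemeasurable, (measurable_seqShift _).aemeasurable, by
        rw [hmap, (measurePreserving_seqShift _).map_eq]⟩
    have h2 := h1.comp (measurable_logVol θ (t - n))
    simp only [Function.comp_def, logVol_seqShift, add_neg_cancel] at h2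
    exact h2
  -- Each of the two terms of D_{t-n} has a law independent of n, so its product with βⁿ vanishes in
  -- probability. Treating them separately requires neither their joint law nor moments of log σ_t².
  have hsmall : ∀ ε : ℝ, 0 < ε → ∀ᵐ ω ∂P, |D t ω| < 2 * ε := by
    intro ε hε
    have h1 := (tendsto_measure_le_abs_mul hU hb hε).add (tendsto_measure_le_abs_mul hV hb hε)
    rw [add_zero] at h1
    have h2 : P {ω | ¬ |D t ω| < 2 * ε} ≤ 0 := by
      refine ge_of_tendsto' h1 fun n => ?_
      refine le_trans (measure_mono_ae ?_) (measure_union_le _ _)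
      filter_upwards [hpow] with ω hω hlt
      by_contra hcon
      have hcon' : ¬ (ε ≤ |θ.β ^ n * Real.log (σ (t - n) ω ^ 2)| ∨
          ε ≤ |θ.β ^ n * logVol θ (fun k => Z k ω) (t - n)|) := hcon
      push Not at hcon'
      refine hlt ?_
      rw [hω n]
      simp only [hD, mul_sub]
      exact (abs_sub _ _).trans_lt (by linarith)
    exact le_antisymm h2 zero_le
  have h6 : ∀ᵐ ω ∂P, ∀ n : ℕ, |D t ω| < 2 * (1 / ((n : ℝ) + 1)) :=
    ae_all_iff.mpr fun n => hsmall _ Nat.one_div_pos_of_nat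
  filter_upwards [h6] with ω hω
  have h7 := ge_of_tendsto' (tendsto_one_div_add_atTop_nhds_zero_nat.const_mul (2 : ℝ))
    fun n => (hω n).le
  rw [mul_zero] at h7
  exact sub_eq_zero.mp (abs_nonpos_iff.mp h7)

/-- A stationary EGARCH process is a function of its innovations. -/
theorem ae_eq_egarch (h : IsStationaryEGARCH P θ Z X σ) (hθ : θ ∈ paramSpace) :
    ∀ᵐ ω ∂P, (fun t => X t ω) = egarch θ fun k => Z k ω := by
  filter_upwards [ae_all_iff.mpr (ae_log_sq_eq_logVol h hθ), ae_all_iff.mpr h.pos,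
    ae_all_iff.mpr h.eq_mul] with ω h1 h2 h3
  funext t
  rw [h3 t, egarch, ← h1 t, Real.log_pow, Nat.cast_ofNat, mul_div_cancel_left₀ _ two_ne_zero,
    Real.exp_log (h2 t)]

end Representation

/-! ### Truncating a logarithm with negative, possibly infinite, mean -/

section NegativeMean

variable {S : Type*} [MeasurableSpace S] {μ : Measure S} [IsFiniteMeasure μ]

/-- If `log Y` has a negative mean, then so does `log (max Y r)` for some `r > 0`. -/
lemma exists_integral_log_max_neg {Y : S → ℝ} (hY : Measurable Y) (hY0 : ∀ x, 0 ≤ Y x)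
    (h : HasNegativeMean μ fun x => extLog (Y x)) :
    ∃ r : ℝ, 0 < r ∧ Integrable (fun x => Real.log (max (Y x) r)) μ ∧
      ∫ x, Real.log (max (Y x) r) ∂μ < 0 := by
  have hf : ∀ n : ℕ, Measurable fun x => Real.log (max (Y x) (Real.exp (-n))) := fun n =>
    (hY.max measurable_const).log
  -- With truncation at exp(-n), the negative parts increase to that of log Y, including the value ∞
  -- where Y = 0. Monotone convergence then yields an n whose negative part already outweighs the
  -- positive part.
  have hmono : Monotone fun (n : ℕ) x => ENNReal.ofReal (-Real.log (max (Y x) (Real.exp (-n)))) := by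
    intro n k hnk x
    refine ENNReal.ofReal_le_ofReal (neg_le_neg (Real.log_le_log ?_ ?_))
    · exact lt_max_of_lt_right (Real.exp_pos _)
    · exact max_le_max le_rfl (Real.exp_le_exp.mpr (neg_le_neg (Nat.cast_le.mpr hnk)))
  have hsup : ∀ x, (-extLog (Y x)).toENNReal ≤
      ⨆ n : ℕ, ENNReal.ofReal (-Real.log (max (Y x) (Real.exp (-n)))) := by
    intro x
    rcases (hY0 x).eq_or_lt with h0 | h0
    · have e : ∀ n : ℕ, ENNReal.ofReal (-Real.log (max (Y x) (Real.exp (-n)))) = n := fun n => by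
        rw [← h0, max_eq_right (Real.exp_pos _).le, Real.log_exp, neg_neg, ENNReal.ofReal_natCast]
      simp_rw [e, ENNReal.iSup_natCast]
      exact le_top
    · obtain ⟨n, hn⟩ := exists_nat_ge (-Real.log (Y x))
      refine le_iSup_of_le n ?_
      have e : Real.exp (-n) ≤ Y x := by
        rw [← Real.exp_log h0]
        exact Real.exp_le_exp.mpr (by linarith)
      rw [max_eq_left e, extLog, ENNReal.log_ofReal_of_pos h0, ← EReal.coe_neg,
        EReal.toENNReal_of_ne_top (EReal.coe_ne_top _), EReal.toReal_coe]
  have hlt : ∫⁻ x, (extLog (Y x)).toENNReal ∂μ <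
      ⨆ n : ℕ, ∫⁻ x, ENNReal.ofReal (-Real.log (max (Y x) (Real.exp (-n)))) ∂μ := by
    have hg : ∀ n : ℕ, Measurable fun x =>
        ENNReal.ofReal (-Real.log (max (Y x) (Real.exp (-n)))) := fun n => (hf n).neg.ennreal_ofReal
    rw [← lintegral_iSup hg hmono]
    exact h.trans_le (lintegral_mono hsup)
  obtain ⟨n, hn⟩ := lt_iSup_iff.mp hlt
  -- Since exp(-n) ≤ 1, truncation does not enlarge the positive part.
  have hpos : ∀ x, ENNReal.ofReal (Real.log (max (Y x) (Real.exp (-n))))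
      ≤ (extLog (Y x)).toENNReal := by
    intro x
    rcases le_total (Y x) (Real.exp (-n)) with h1 | h1
    · rw [max_eq_right h1, Real.log_exp, ENNReal.ofReal_of_nonpos (by simp)]
      exact zero_le
    · have h0 := (Real.exp_pos _).trans_le h1
      rw [max_eq_left h1, extLog, ENNReal.log_ofReal_of_pos h0,
        EReal.toENNReal_of_ne_top (EReal.coe_ne_top _), EReal.toReal_coe]
  have hplt := (lintegral_mono hpos).trans_lt hn
  have hnfin : ∫⁻ x, ENNReal.ofReal (-Real.log (max (Y x) (Real.exp (-n)))) ∂μ ≠ ∞ := by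
    refine ((lintegral_mono (g := fun _ => ENNReal.ofReal n) fun x => ?_).trans_lt ?_).ne
    · refine ENNReal.ofReal_le_ofReal ?_
      have := Real.log_le_log (Real.exp_pos _) (le_max_right (Y x) (Real.exp (-n)))
      rw [Real.log_exp] at this
      linarith
    · rw [lintegral_const]
      exact ENNReal.mul_lt_top ENNReal.ofReal_lt_top (measure_lt_top _ _)
  have hint : Integrable (fun x => Real.log (max (Y x) (Real.exp (-n)))) μ := by
    refine ⟨(hf n).aestronglyMeasurable, ?_⟩
    have e : ∀ x, ‖Real.log (max (Y x) (Real.exp (-n)))‖ₑ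
        ≤ ENNReal.ofReal (Real.log (max (Y x) (Real.exp (-n))))
          + ENNReal.ofReal (-Real.log (max (Y x) (Real.exp (-n)))) := by
      intro x
      rw [Real.enorm_eq_ofReal_abs]
      rcases abs_choice (Real.log (max (Y x) (Real.exp (-n)))) with h' | h' <;> rw [h']
      · exact le_self_add
      · exact le_add_self
    refine (lintegral_mono e).trans_lt ?_
    rw [lintegral_add_left (hf n).ennreal_ofReal]
    exact ENNReal.add_lt_top.mpr ⟨hplt.trans_le le_top, hnfin.lt_top⟩
  refine ⟨Real.exp (-n), Real.exp_pos _, hint, ?_⟩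
  rw [integral_eq_lintegral_pos_part_sub_lintegral_neg_part hint, sub_neg]
  exact (ENNReal.toReal_lt_toReal (hplt.trans_le le_top).ne hnfin).mpr hplt

end NegativeMean

/-! ### Contraction on average along the canonical process -/

section Contraction

lemma backIter_shift (x : ℤ → ℝ) (θ : Param) (s : ℤ) (n : ℕ) (t : ℤ) :
    backIter (fun k => x (k + s)) θ n t = backIter x θ n (t + s) := by
  induction n generalizing t with
  | zero => rfl
  | succ n ih => rw [backIter, backIter, ih, sub_add_eq_add_sub]

lemma backIter_congr {x y : ℤ → ℝ} (θ : Param) (n : ℕ) {t : ℤ} (h : ∀ k < t, x k = y k) :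
    backIter x θ n t = backIter y θ n t := by
  induction n generalizing t with
  | zero => rfl
  | succ n ih =>
    rw [backIter, backIter, h _ (sub_one_lt t), ih fun k hk => h k (hk.trans (sub_one_lt t))]

lemma statLog_congr {x y : ℤ → ℝ} (θ : Param) {t : ℤ} (h : ∀ k < t, x k = y k) :
    statLog x θ t = statLog y θ t := by
  simp only [statLog, backIter_congr θ _ h]

lemma statLog_egarch_seqShift (θ₀ θ : Param) (z : ℤ → ℝ) (s t : ℤ) :
    statLog (egarch θ₀ (seqShift s z)) θ t = statLog (egarch θ₀ z) θ (t + s) := by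
  have e : egarch θ₀ (seqShift s z) = fun k => egarch θ₀ z (k + s) :=
    funext fun k => egarch_seqShift θ₀ z s k
  simp only [e, statLog, backIter_shift]

lemma measurable_backIter_egarch (θ₀ θ : Param) (n : ℕ) (t : ℤ) :
    Measurable fun z => backIter (egarch θ₀ z) θ n t := by
  induction n generalizing t with
  | zero => exact measurable_const
  | succ n ih =>
    have h1 := ih (t - 1)
    have h2 := measurable_egarch θ₀ (t - 1)
    simp only [backIter, logStep]
    fun_prop

/-- As a limsup, `statLog` is measurable on the whole sequence space, with no appeal to convergence.
-/
lemma measurable_statLog_egarch (θ₀ θ : Param) (t : ℤ) :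
    Measurable fun z => statLog (egarch θ₀ z) θ t :=
  Measurable.limsup fun n => measurable_backIter_egarch θ₀ θ n t

lemma ae_seqShift {ν : Measure ℝ} [IsProbabilityMeasure ν] {p : (ℤ → ℝ) → Prop}
    (h : ∀ᵐ z ∂(iidLaw ν), p z) : ∀ᵐ z ∂(iidLaw ν), ∀ t, p (seqShift t z) :=
  ae_all_iff.mpr fun t => (measurePreserving_seqShift t).quasiMeasurePreserving.ae h

variable {ν : Measure ℝ} [IsProbabilityMeasure ν] {θ₀ : Param} {K : Set Param}
  (hK : IsCompact K) (hKΘ : K ⊆ paramSpace) (hθ₀ : θ₀ ∈ K)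
  (hlam : HasNegativeMean (iidLaw ν) fun z => extLog (lipSup K (egarch θ₀ z 0)))

lemma prod_lipSup_le (θ₀ : Param) (K : Set Param) {r : ℝ} (hr : 0 < r) (z : ℤ → ℝ) (s : ℤ)
    (n : ℕ) : ∏ j ∈ Finset.range n, lipSup K (egarch θ₀ z (j * s)) ≤
      Real.exp (birkhoffSum (seqShift s)
        (fun z => Real.log (max (lipSup K (egarch θ₀ z 0)) r)) n z) := by
  rw [birkhoffSum, Real.exp_sum]
  refine Finset.prod_le_prod (fun _ _ => lipSup_nonneg _) fun j _ => ?_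
  rw [Real.exp_log (lt_max_of_lt_right hr), seqShift_iterate, egarch_seqShift, zero_add]
  exact le_max_left _ _

include hK hθ₀ hlam in
-- The logarithm of the product is at most a Birkhoff sum of the truncated logarithm, which has
-- negative mean. The step s = 1 serves forward products and s = -1 backward ones.
lemma exists_ae_eventually_prod_le {s : ℤ} (hs : s ≠ 0) : ∃ c < (0 : ℝ), ∀ᵐ z ∂(iidLaw ν),
    ∀ᶠ n : ℕ in atTop, ∏ j ∈ Finset.range n, lipSup K (egarch θ₀ z (j * s)) ≤ Real.exp c ^ n := by
  have hm : Measurable fun z => lipSup K (egarch θ₀ z 0) :=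
    (measurable_lipSup hK ⟨θ₀, hθ₀⟩).comp (measurable_egarch θ₀ 0)
  obtain ⟨r, hr, hint, hneg⟩ := exists_integral_log_max_neg hm (fun _ => lipSup_nonneg _) hlam
  obtain ⟨c, hc, hc0⟩ := exists_between hneg
  refine ⟨c, hc0, ?_⟩
  filter_upwards [ae_eventually_birkhoffSum_le (ergodic_seqShift hs)
    (hm.max measurable_const).log hint hc] with z hz
  filter_upwards [hz] with n hn
  refine (prod_lipSup_le θ₀ K hr z s n).trans ?_
  rw [← Real.exp_nat_mul, mul_comm]
  exact Real.exp_le_exp.mpr hn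

include hK hθ₀ hlam in
theorem ae_isContractive : ∀ᵐ z ∂(iidLaw ν), IsContractive K (egarch θ₀ z) := by
  obtain ⟨c, hc, h⟩ := exists_ae_eventually_prod_le hK hθ₀ hlam (s := 1) one_ne_zero
  obtain ⟨d, hd, h'⟩ := exists_ae_eventually_prod_le hK hθ₀ hlam (s := -1) (by norm_num)
  filter_upwards [h, ae_seqShift h'] with z hz hz'
  refine ⟨fun t => ?_, ?_⟩
  · have hg : Summable fun n : ℕ => Real.exp d ^ n :=
      summable_geometric_of_lt_one (Real.exp_pos d).le (Real.exp_lt_one_iff.mpr hd)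
    refine Summable.of_norm_bounded_eventually_nat hg ?_
    filter_upwards [hz' (t - 1)] with n hn
    rw [Real.norm_of_nonneg (backProd_nonneg _ _ _ _), backProd]
    convert! hn using 3 with j
    rw [egarch_seqShift]
    congr 1
    ring
  · refine squeeze_zero' (Eventually.of_forall fun n =>
      Finset.prod_nonneg fun _ _ => lipSup_nonneg _) ?_
      (tendsto_pow_atTop_nhds_zero_of_lt_one (Real.exp_pos c).le (Real.exp_lt_one_iff.mpr hc))
    filter_upwards [hz] with n hn
    simpa [forwProd] using hn

variable (hν : Integrable (fun y => y) ν)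

include hK hKΘ hθ₀ hlam hν in
/-- At the true parameter, the recursion started in the infinite past recovers the volatility. -/
theorem ae_statLog_eq_logVol :
    ∀ᵐ z ∂(iidLaw ν), ∀ t, statLog (egarch θ₀ z) θ₀ t = logVol θ₀ z t := by
  set d : (ℤ → ℝ) → ℝ := fun z => statLog (egarch θ₀ z) θ₀ 0 - logVol θ₀ z 0 with hd
  have hdm : Measurable d := (measurable_statLog_egarch θ₀ θ₀ 0).sub (measurable_logVol θ₀ 0)
  have hds : ∀ z t, d (seqShift t z) = statLog (egarch θ₀ z) θ₀ t - logVol θ₀ z t := by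
    intro z t
    simp only [hd, statLog_egarch_seqShift, logVol_seqShift, zero_add]
  -- Both log-volatilities solve the same data recursion at θ₀, so their difference at time n is at
  -- most the forward product times the initial difference. Its law does not depend on n, so a
  -- difference tending to zero must vanish.
  have hlim : ∀ᵐ z ∂(iidLaw ν), Tendsto (fun n : ℕ => d (seqShift n z)) atTop (𝓝 0) := by
    filter_upwards [ae_isContractive hK hθ₀ hlam, ae_shockSum_ne_top (hKΘ hθ₀) hν] with z hz hfin
    have hb : ∀ n : ℕ, |d (seqShift n z)| ≤ forwProd K (egarch θ₀ z) n * |d z| := by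
      intro n
      induction n with
      | zero =>
        rw [hds]
        simp [forwProd, hd]
      | succ n ih =>
        rw [hds] at ih ⊢
        have e1 := statLog_eq_logStep hK hKΘ hz hθ₀ ((n + 1 : ℕ) : ℤ)
        have e2 := logStep_egarch (hKΘ hθ₀) (hfin n)
        push_cast at e1 ⊢
        rw [add_sub_cancel_right] at e1
        rw [e1, ← e2]
        have hm := lowerBound_le_baseLevel hK hKΘ hθ₀
        refine (abs_logStep_sub_le hK hKΘ _ hθ₀ le_rfl ?_ ?_).trans ?_
        · linarith [lowerBound_le_statLog hK hKΘ hz hθ₀ n]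
        · linarith [baseLevel_le_logVol θ₀ z n]
        · rw [Real.exp_zero, one_mul, forwProd, Finset.prod_range_succ, mul_comm _ (lipSup _ _),
            mul_assoc]
          exact mul_le_mul_of_nonneg_left ih (lipSup_nonneg _)
    refine squeeze_zero_norm (fun n => hb n) ?_
    simpa using hz.tendsto_forwProd.mul_const |d z|
  have h0 := ae_eq_zero_of_tendsto hdm (fun n : ℕ => measurePreserving_seqShift (ν := ν) n) hlim
  filter_upwards [ae_seqShift h0] with z hz t
  have := hz t
  rw [hds] at this
  exact sub_eq_zero.mp this

end Contraction

/-! ### Identifiability of the parameter -/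

section Identification

/-- Two independent random variables with a vanishing sum are constant. -/
lemma exists_ae_eq_const_of_indepFun {S : Type*} [MeasurableSpace S] {μ : Measure S}
    [IsProbabilityMeasure μ] {U V : S → ℝ} (hU : Measurable U) (hV : Measurable V)
    (h : IndepFun U V μ) (h0 : ∀ᵐ x ∂μ, U x + V x = 0) : ∃ c, ∀ᵐ x ∂μ, V x = c := by
  have : IsProbabilityMeasure (μ.map U) := Measure.isProbabilityMeasure_map hU.aemeasurable
  have : IsProbabilityMeasure (μ.map V) := Measure.isProbabilityMeasure_map hV.aemeasurable
  have hs : MeasurableSet {p : ℝ × ℝ | p.1 + p.2 = 0} :=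
    measurableSet_eq_fun (by fun_prop) measurable_const
  have h1 : ∀ᵐ p ∂((μ.map U).prod (μ.map V)), p.1 + p.2 = 0 := by
    rw [← (indepFun_iff_map_prod_eq_prod_map_map hU.aemeasurable hV.aemeasurable).mp h]
    exact (ae_map_iff (hU.prodMk hV).aemeasurable hs).mpr h0
  -- By Fubini, some single value u of U satisfies u + V = 0 almost surely.
  obtain ⟨u, hu⟩ := (Measure.ae_ae_of_ae_prod h1).exists
  refine ⟨-u, ?_⟩
  filter_upwards [ae_of_ae_map hV.aemeasurable hu] with x hx
  linarith

variable {ν : Measure ℝ} [IsProbabilityMeasure ν]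

/-- The sequence of the innovations before time zero. -/
noncomputable def pastPart (z : ℤ → ℝ) (k : ℤ) : ℝ := if k < 0 then z k else 0

/-- Functions of the innovations before time zero are independent of the innovation at zero. -/
lemma indepFun_eval_of_pastPart {u : (ℤ → ℝ) → ℝ} (hu : Measurable u)
    (h : ∀ z, u (pastPart z) = u z) : IndepFun u (fun z => z 0) (iidLaw ν) := by
  let m : ℤ → MeasurableSpace (ℤ → ℝ) := fun k => MeasurableSpace.comap (fun z => z k) inferInstance
  have hle : ∀ k, m k ≤ MeasurableSpace.pi := fun k => (measurable_pi_apply k).comap_le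
  have hind : iIndep m (iidLaw ν) := iIndepFun_eval
  have hdisj : Disjoint (Set.Iio (0 : ℤ)) {0} := by simp
  have hI := indep_iSup_of_disjoint hle hind hdisj
  have hp : Measurable[⨆ k ∈ Set.Iio (0 : ℤ), m k] (pastPart : (ℤ → ℝ) → ℤ → ℝ) := by
    refine @measurable_pi_lambda _ _ _ (⨆ k ∈ Set.Iio (0 : ℤ), m k) _ _ fun k => ?_
    by_cases hk : k < 0
    · simp only [pastPart, hk, if_true]
      have h1 : m k ≤ ⨆ k ∈ Set.Iio (0 : ℤ), m k := le_iSup₂_of_le k hk le_rfl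
      exact (comap_measurable (fun z : ℤ → ℝ => z k)).mono h1 le_rfl
    · simp only [pastPart, hk, if_false]
      exact @measurable_const _ _ _ (⨆ k ∈ Set.Iio (0 : ℤ), m k) 0
  have e : u = u ∘ pastPart := funext fun z => (h z).symm
  rw [IndepFun_iff_Indep]
  refine indep_of_indep_of_le_right (indep_of_indep_of_le_left hI ?_) ?_
  · rw [e]
    exact (hu.comp hp).comap_le
  · exact le_iSup₂_of_le (0 : ℤ) (Set.mem_singleton _) le_rfl

lemma egarch_pastPart (θ : Param) (z : ℤ → ℝ) {k : ℤ} (hk : k < 0) :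
    egarch θ (pastPart z) k = egarch θ z k := by
  have h1 : ∀ j ≤ k, pastPart z j = z j := fun j hj => if_pos (hj.trans_lt hk)
  rw [egarch, egarch, h1 k le_rfl, logVol_congr θ fun j hj => h1 j hj.le]

lemma logVol_pastPart (θ : Param) (z : ℤ → ℝ) : logVol θ (pastPart z) 0 = logVol θ z 0 :=
  logVol_congr θ fun _ hk => if_pos hk

lemma statLog_pastPart (θ₀ θ : Param) (z : ℤ → ℝ) :
    statLog (egarch θ₀ (pastPart z)) θ 0 = statLog (egarch θ₀ z) θ 0 :=
  statLog_congr θ fun _ hk => egarch_pastPart θ₀ z hk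

variable (hν : Integrable (fun y => y) ν) (hmean : ∫ y, y ∂ν = 0)
  (hndeg : ∀ a b : ℝ, ¬ ∀ᵐ y ∂ν, y = a ∨ y = b)

include hν hmean hndeg

omit [IsProbabilityMeasure ν] in
/-- The shock `p Z + q |Z|` is constant only if it vanishes identically. -/
lemma eq_zero_of_ae_shock_eq_const {p q c : ℝ} (h : ∀ᵐ y ∂ν, p * y + q * |y| = c) :
    p = 0 ∧ q = 0 := by
  have hzero : ¬ ∀ᵐ y ∂ν, y = 0 := fun h' => hndeg 0 0 (by
    filter_upwards [h'] with y hy using Or.inl hy)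
  have hnn : ¬ ∀ᵐ y ∂ν, 0 ≤ y := fun h' =>
    hzero ((integral_eq_zero_iff_of_nonneg_ae h' hν).mp hmean)
  have hnp : ¬ ∀ᵐ y ∂ν, y ≤ 0 := by
    intro h'
    have h1 := (integral_eq_zero_iff_of_nonneg_ae (f := fun y => -y)
      (by filter_upwards [h'] with y hy using neg_nonneg.mpr hy) hν.neg).mp
      (by rw [integral_neg, hmean, neg_zero])
    exact hzero (by filter_upwards [h1] with y hy using neg_eq_zero.mp hy)
  have hsplit : ∀ᵐ y ∂ν, (0 < y ∧ (p + q) * y = c) ∨ (y < 0 ∧ (p - q) * y = c) ∨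
      (y = 0 ∧ c = 0) := by
    filter_upwards [h] with y hy
    rcases lt_trichotomy y 0 with h0 | h0 | h0
    · rw [abs_of_neg h0] at hy
      exact Or.inr (Or.inl ⟨h0, by linarith⟩)
    · rw [h0] at hy
      exact Or.inr (Or.inr ⟨h0, by simpa using hy.symm⟩)
    · rw [abs_of_pos h0] at hy
      exact Or.inl ⟨h0, by linarith⟩
  -- The shock is linear with slopes p + q and p - q on the two half-lines, and a nonzero slope
  -- allows at most one point on its half-line. If exactly one slope vanishes, c = 0 makes the law
  -- one-sided, contradicting the zero mean, and c ≠ 0 leaves one point. If neither vanishes, two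
  -- points remain.
  by_cases h1 : p + q = 0 <;> by_cases h2 : p - q = 0
  · constructor <;> linarith
  · exfalso
    rcases eq_or_ne c 0 with rfl | hc
    · refine hnn ?_
      filter_upwards [hsplit] with y hy
      rcases hy with hy | hy | hy
      · exact hy.1.le
      · exact ((mul_eq_zero.mp hy.2).resolve_left h2).ge
      · exact hy.1.ge
    · refine hndeg (c / (p - q)) (c / (p - q)) ?_
      filter_upwards [hsplit] with y hy
      rcases hy with hy | hy | hy
      · rw [h1, zero_mul] at hy
        exact absurd hy.2.symm hc
      · exact Or.inl (by rw [eq_div_iff h2, mul_comm]; exact hy.2)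
      · exact absurd hy.2 hc
  · exfalso
    rcases eq_or_ne c 0 with rfl | hc
    · refine hnp ?_
      filter_upwards [hsplit] with y hy
      rcases hy with hy | hy | hy
      · exact ((mul_eq_zero.mp hy.2).resolve_left h1).le
      · exact hy.1.le
      · exact hy.1.le
    · refine hndeg (c / (p + q)) (c / (p + q)) ?_
      filter_upwards [hsplit] with y hy
      rcases hy with hy | hy | hy
      · exact Or.inl (by rw [eq_div_iff h1, mul_comm]; exact hy.2)
      · rw [h2, zero_mul] at hy
        exact absurd hy.2.symm hc
      · exact absurd hy.2 hc
  · exfalso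
    refine hndeg (c / (p + q)) (c / (p - q)) ?_
    filter_upwards [hsplit] with y hy
    rcases hy with hy | hy | hy
    · exact Or.inl (by rw [eq_div_iff h1, mul_comm]; exact hy.2)
    · exact Or.inr (by rw [eq_div_iff h2, mul_comm]; exact hy.2)
    · exact Or.inl (by rw [hy.1, hy.2, zero_div])

lemma eq_zero_of_ae_shock_eval_eq_const {p q c : ℝ}
    (h : ∀ᵐ z ∂(iidLaw ν), p * z 0 + q * |z 0| = c) : p = 0 ∧ q = 0 := by
  refine eq_zero_of_ae_shock_eq_const hν hmean hndeg (c := c) ?_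
  have hs : MeasurableSet {y : ℝ | p * y + q * |y| = c} :=
    measurableSet_eq_fun (by fun_prop) measurable_const
  have hmp := measurePreserving_eval_infinitePi (fun _ : ℤ => ν) 0
  rw [← hmp.map_eq]
  exact (ae_map_iff hmp.measurable.aemeasurable hs).mpr h

variable {θ₀ θ : Param} {K : Set Param} (hK : IsCompact K) (hKΘ : K ⊆ paramSpace) (hθ₀ : θ₀ ∈ K)
  (hlam : HasNegativeMean (iidLaw ν) fun z => extLog (lipSup K (egarch θ₀ z 0)))
  (hγδ : (θ₀.γ, θ₀.δ) ≠ (0, 0))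

include hK hKΘ hθ₀ hlam hγδ

/-- The volatility identifies the parameter. -/
theorem eq_of_ae_statLog_eq_logVol (hθ : θ ∈ K)
    (h : ∀ᵐ z ∂(iidLaw ν), statLog (egarch θ₀ z) θ 0 = logVol θ₀ z 0) : θ = θ₀ := by
  have hrec : ∀ᵐ z ∂(iidLaw ν), logVol θ₀ z 1
      = θ₀.α + θ₀.β * logVol θ₀ z 0 + θ₀.γ * z 0 + θ₀.δ * |z 0| := by
    filter_upwards [ae_shockSum_ne_top (hKΘ hθ₀) hν] with z hz
    simpa using logVol_succ (hKΘ hθ₀) (hz 0)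
  -- By shift invariance `statLog` equals `logVol` at times 0 and 1. Subtracting the two recursions
  -- for time 1 leaves a function of the past plus a function of Z_0, which are independent, so the
  -- latter is constant.
  have hdiff : ∀ᵐ z ∂(iidLaw ν), ((θ.β - θ₀.β) * logVol θ₀ z 0 + (θ.α - θ₀.α))
      + ((θ.γ - θ₀.γ) * z 0 + (θ.δ - θ₀.δ) * |z 0|) = 0 := by
    filter_upwards [hrec, ae_seqShift h, ae_isContractive hK hθ₀ hlam] with z h1 h2 hz
    have e0 := h2 0
    have e1 := h2 1
    rw [statLog_egarch_seqShift, logVol_seqShift] at e0 e1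
    rw [add_zero] at e0
    rw [zero_add] at e1
    have h3 := statLog_eq_logStep hK hKΘ hz hθ 1
    rw [sub_self, e0, e1, h1, logStep, egarch, abs_mul, abs_of_pos (Real.exp_pos _)] at h3
    have e : Real.exp (logVol θ₀ z 0 / 2) * Real.exp (-logVol θ₀ z 0 / 2) = 1 := by
      rw [← Real.exp_add, neg_div, add_neg_cancel, Real.exp_zero]
    linear_combination -h3 - (θ.γ * z 0 + θ.δ * |z 0|) * e
  have hL := measurable_logVol θ₀ 0
  have hind : IndepFun (fun z => (θ.β - θ₀.β) * logVol θ₀ z 0 + (θ.α - θ₀.α))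
      (fun z => (θ.γ - θ₀.γ) * z 0 + (θ.δ - θ₀.δ) * |z 0|) (iidLaw ν) :=
    (indepFun_eval_of_pastPart (ν := ν) hL (logVol_pastPart θ₀)).comp
      (φ := fun l => (θ.β - θ₀.β) * l + (θ.α - θ₀.α))
      (ψ := fun y => (θ.γ - θ₀.γ) * y + (θ.δ - θ₀.δ) * |y|) (by fun_prop) (by fun_prop)
  obtain ⟨c, hc⟩ := exists_ae_eq_const_of_indepFun (by fun_prop) (by fun_prop) hind hdiff
  obtain ⟨hγ, hδ⟩ := eq_zero_of_ae_shock_eval_eq_const hν hmean hndeg hc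
  rw [hγ, hδ] at hdiff
  simp only [zero_mul, add_zero] at hdiff
  -- Otherwise the true log-volatility is constant, hence so is the true shock, against (γ₀, δ₀) ≠
  -- (0, 0).
  have hβ : θ.β - θ₀.β = 0 := by
    by_contra hne
    have hconst : ∀ᵐ z ∂(iidLaw ν), logVol θ₀ z 0 = (θ₀.α - θ.α) / (θ.β - θ₀.β) := by
      filter_upwards [hdiff] with z hz
      rw [eq_div_iff hne]
      linarith
    have h4 := eq_zero_of_ae_shock_eval_eq_const hν hmean hndeg (p := θ₀.γ) (q := θ₀.δ)
      (c := (θ₀.α - θ.α) / (θ.β - θ₀.β) - θ₀.α - θ₀.β * ((θ₀.α - θ.α) / (θ.β - θ₀.β))) (by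
        filter_upwards [hrec, ae_seqShift hconst] with z h1 h2
        have e0 := h2 0
        have e1 := h2 1
        rw [logVol_seqShift] at e0 e1
        rw [add_zero] at e0
        rw [zero_add] at e1
        rw [e0, e1] at h1
        linarith)
    exact hγδ (Prod.ext h4.1 h4.2)
  have hα : θ.α - θ₀.α = 0 := by
    obtain ⟨z, hz⟩ := hdiff.exists
    rw [hβ] at hz
    linarith
  ext i
  fin_cases i
  · exact sub_eq_zero.mp hα
  · exact sub_eq_zero.mp hβ
  · exact sub_eq_zero.mp hγ
  · exact sub_eq_zero.mp hδ

end Identification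

/-! ### The expected likelihood contribution -/

section Likelihood

/-- The stationary version of the likelihood contribution `X_t² / h_t(θ) + log h_t(θ)`. -/
noncomputable def statLik (θ₀ θ : Param) (z : ℤ → ℝ) (t : ℤ) : ℝ :=
  egarch θ₀ z t ^ 2 * Real.exp (-statLog (egarch θ₀ z) θ t) + statLog (egarch θ₀ z) θ t

lemma statLik_seqShift (θ₀ θ : Param) (z : ℤ → ℝ) (s t : ℤ) :
    statLik θ₀ θ (seqShift s z) t = statLik θ₀ θ z (t + s) := by
  rw [statLik, statLik, statLog_egarch_seqShift, egarch_seqShift]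

lemma measurable_statLik (θ₀ θ : Param) (t : ℤ) : Measurable fun z => statLik θ₀ θ z t := by
  have h1 := measurable_egarch θ₀ t
  have h2 := measurable_statLog_egarch θ₀ θ t
  unfold statLik
  fun_prop

/-- This separates the innovation at t from the log-volatilities, which depend only on the past when
l is `statLog`. -/
lemma egarch_sq_mul_exp (θ₀ : Param) (z : ℤ → ℝ) (t : ℤ) (l : ℝ) :
    egarch θ₀ z t ^ 2 * Real.exp (-l) = Real.exp (logVol θ₀ z t - l) * z t ^ 2 := by
  have e : Real.exp (logVol θ₀ z t / 2) ^ 2 = Real.exp (logVol θ₀ z t) := by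
    rw [← Real.exp_nat_mul]
    congr 1
    push_cast
    ring
  rw [egarch, mul_pow, e, sub_eq_add_neg, Real.exp_add]
  ring

variable {ν : Measure ℝ} [IsProbabilityMeasure ν]
  (hν : Integrable (fun y => y) ν) (hmean : ∫ y, y ∂ν = 0)
  (hsq : Integrable (fun y => y ^ 2) ν) (hvar : ∫ y, y ^ 2 ∂ν = 1)
  (hndeg : ∀ a b : ℝ, ¬ ∀ᵐ y ∂ν, y = a ∨ y = b)
  {θ₀ θ : Param} {K : Set Param} (hK : IsCompact K) (hKΘ : K ⊆ paramSpace) (hθ₀ : θ₀ ∈ K)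
  (hlam : HasNegativeMean (iidLaw ν) fun z => extLog (lipSup K (egarch θ₀ z 0)))
  (hγδ : (θ₀.γ, θ₀.δ) ≠ (0, 0))

include hsq in
lemma integrable_eval_sq (k : ℤ) : Integrable (fun z => z k ^ 2) (iidLaw ν) :=
  (measurePreserving_eval_infinitePi (fun _ : ℤ => ν) k).integrable_comp_of_integrable hsq

include hvar in
lemma integral_eval_sq (k : ℤ) : ∫ z, z k ^ 2 ∂(iidLaw ν) = 1 := by
  have h := measurePreserving_eval_infinitePi (fun _ : ℤ => ν) k
  have h1 := integral_map (μ := iidLaw ν) h.measurable.aemeasurable (f := fun y : ℝ => y ^ 2)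
    (by fun_prop)
  rw [h.map_eq, hvar] at h1
  exact h1.symm

include hν hmean hsq hvar hndeg hK hKΘ hθ₀ hlam hγδ in
/-- The expected likelihood contribution is uniquely minimized at the true parameter. -/
theorem lt_lintegral_statLik (hθ : θ ∈ K) (hne : θ ≠ θ₀) :
    ENNReal.ofReal (1 + ∫ z, logVol θ₀ z 0 ∂(iidLaw ν) - lowerBound K)
      < ∫⁻ z, ENNReal.ofReal (statLik θ₀ θ z 0 - lowerBound K) ∂(iidLaw ν) := by
  set μ := iidLaw ν with hμ
  set m := lowerBound K
  set L : (ℤ → ℝ) → ℝ := fun z => logVol θ₀ z 0 with hL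
  set l : (ℤ → ℝ) → ℝ := fun z => statLog (egarch θ₀ z) θ 0 with hl
  have hLm : Measurable L := measurable_logVol θ₀ 0
  have hlm : Measurable l := measurable_statLog_egarch θ₀ θ 0
  have hLint : Integrable L μ := integrable_logVol (hKΘ hθ₀) hν 0
  have hml : ∀ᵐ z ∂μ, 0 ≤ l z - m := by
    filter_upwards [ae_isContractive hK hθ₀ hlam] with z hz
    exact sub_nonneg.mpr (lowerBound_le_statLog hK hKΘ hz hθ 0)
  -- No integrability of l is known beforehand. The assumed upper bound supplies it, since both
  -- terms in the splitting below are nonnegative.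
  by_contra hcon
  have hle := not_lt.mp hcon
  have hsplit : ∫⁻ z, ENNReal.ofReal (statLik θ₀ θ z 0 - m) ∂μ =
      ∫⁻ z, ENNReal.ofReal (Real.exp (L z - l z)) ∂μ + ∫⁻ z, ENNReal.ofReal (l z - m) ∂μ := by
    have hind : IndepFun (fun z => ENNReal.ofReal (Real.exp (L z - l z)))
        (fun z => ENNReal.ofReal (z 0 ^ 2)) μ :=
      (indepFun_eval_of_pastPart (ν := ν) (hLm.sub hlm) fun z => by
        simp only [hL, hl, Pi.sub_apply, logVol_pastPart, statLog_pastPart]).comp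
        (φ := fun u => ENNReal.ofReal (Real.exp u)) (ψ := fun y => ENNReal.ofReal (y ^ 2))
        (by fun_prop) (by fun_prop)
    have hprod := lintegral_mul_eq_lintegral_mul_lintegral_of_indepFun (by fun_prop)
      (by fun_prop) hind
    rw [← ofReal_integral_eq_lintegral_ofReal (integrable_eval_sq hsq 0)
      (ae_of_all _ fun z => sq_nonneg _), integral_eval_sq hvar, ENNReal.ofReal_one,
      mul_one] at hprod
    rw [← hprod, ← lintegral_add_left (by fun_prop)]
    refine lintegral_congr_ae ?_
    filter_upwards [hml] with z hz
    simp only [Pi.mul_apply]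
    rw [← ENNReal.ofReal_mul (Real.exp_pos _).le,
      ← ENNReal.ofReal_add (mul_nonneg (Real.exp_pos _).le (sq_nonneg _)) hz, statLik,
      egarch_sq_mul_exp, add_sub_assoc]
  rw [hsplit] at hle
  have hfin := ENNReal.add_ne_top.mp (hle.trans_lt ENNReal.ofReal_lt_top).ne
  have hexp0 : ∀ᵐ z ∂μ, 0 ≤ Real.exp (L z - l z) := ae_of_all _ fun z => (Real.exp_pos _).le
  have hexp : Integrable (fun z => Real.exp (L z - l z)) μ :=
    (lintegral_ofReal_ne_top_iff_integrable (by fun_prop) hexp0).mp hfin.1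
  have hlmint : Integrable (fun z => l z - m) μ :=
    (lintegral_ofReal_ne_top_iff_integrable (by fun_prop) hml).mp hfin.2
  have hlint : Integrable l μ :=
    (hlmint.add (integrable_const m)).congr (ae_of_all _ fun z => sub_add_cancel (l z) m)
  have hmL : m ≤ ∫ z, L z ∂μ := by
    have h1 := integral_mono (integrable_const (μ := μ) m) hLint fun z =>
      (lowerBound_le_baseLevel hK hKΘ hθ₀).trans (baseLevel_le_logVol θ₀ z 0)
    simpa using h1
  rw [← ofReal_integral_eq_lintegral_ofReal hexp hexp0,
    ← ofReal_integral_eq_lintegral_ofReal hlmint hml,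
    ← ENNReal.ofReal_add (integral_nonneg_of_ae hexp0) (integral_nonneg_of_ae hml),
    ENNReal.ofReal_le_ofReal_iff (by linarith), integral_sub hlint (integrable_const m)] at hle
  simp only [integral_const, probReal_univ, smul_eq_mul, one_mul] at hle
  have hgap0 : ∀ z, 0 ≤ Real.exp (L z - l z) - ((L z - l z) + 1) := fun z =>
    sub_nonneg.mpr (Real.add_one_le_exp _)
  have hLl : Integrable (fun z => L z - l z) μ := hLint.sub hlint
  have hgapint : Integrable (fun z => (L z - l z) + 1) μ := hLl.add (integrable_const 1)
  -- The assumed inequality reads E exp(L - l) ≤ 1 + E(L - l), so the nonnegative gap exp(x) - (x +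
  -- 1) at x = L - l integrates to zero and L = l almost surely.
  have hgap : ∫ z, (Real.exp (L z - l z) - ((L z - l z) + 1)) ∂μ = 0 := by
    refine le_antisymm ?_ (integral_nonneg hgap0)
    have e2 : ∫ z, ((L z - l z) + 1) ∂μ = ∫ z, L z ∂μ - ∫ z, l z ∂μ + 1 := by
      rw [integral_add hLl (integrable_const 1), integral_sub hLint hlint]
      simp
    rw [integral_sub hexp hgapint, e2]
    linarith
  have hzero := (integral_eq_zero_iff_of_nonneg hgap0 (hexp.sub hgapint)).mp hgap
  refine hne (eq_of_ae_statLog_eq_logVol hν hmean hndeg hK hKΘ hθ₀ hlam hγδ hθ ?_)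
  filter_upwards [hzero] with z hz
  by_contra hzne
  have h1 := Real.add_one_lt_exp (x := L z - l z) (sub_ne_zero.mpr (Ne.symm hzne))
  have h2 : Real.exp (L z - l z) - ((L z - l z) + 1) = 0 := hz
  linarith

end Likelihood

/-! ### Local infima and averages along the shift -/

section Averages

/-- A lower bound for an integral extends to the infimum of the integrand over small balls. -/
lemma exists_ball_lt_lintegral {S Y : Type*} [MeasurableSpace S] {μ : Measure S}
    [PseudoMetricSpace Y] [TopologicalSpace.SeparableSpace Y] {φ : S → Y → ℝ≥0∞}
    (hm : ∀ y, Measurable fun z => φ z y) (hc : ∀ᵐ z ∂μ, Continuous (φ z)) {y₀ : Y} {c : ℝ≥0∞}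
    (h : c < ∫⁻ z, φ z y₀ ∂μ) :
    ∃ r > 0, ∃ (M : ℕ) (F : S → ℝ≥0∞), Measurable F ∧ (∀ z, F z ≤ M) ∧ c < ∫⁻ z, F z ∂μ ∧
      ∀ᵐ z ∂μ, ∀ y, dist y y₀ < r → F z ≤ φ z y := by
  classical
  have : Nonempty Y := ⟨y₀⟩
  let d := TopologicalSpace.denseSeq Y
  -- The infimum runs over a dense sequence for measurability. Truncation at k keeps it bounded, and
  -- the value k for points outside the ball is neutral.
  let F : ℕ → S → ℝ≥0∞ := fun k z =>
    ⨅ j, if dist (d j) y₀ < 1 / ((k : ℝ) + 1) then min (φ z (d j)) k else k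
  have hF : ∀ k, Measurable (F k) := fun k => by
    refine Measurable.iInf fun j => ?_
    split_ifs
    · exact (hm (d j)).min measurable_const
    · exact measurable_const
  have hFk : ∀ k z, F k z ≤ k := fun k z => by
    refine (iInf_le _ 0).trans ?_
    split_ifs
    · exact min_le_right _ _
    · exact le_rfl
  have hlim : ∀ᵐ z ∂μ, φ z y₀ ≤ liminf (fun k => F k z) atTop := by
    filter_upwards [hc] with z hz
    refine le_of_forall_lt fun a ha => ?_
    obtain ⟨b, hab, hb⟩ := exists_between ha
    refine hab.trans_le (le_liminf_of_le (by isBoundedDefault) ?_)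
    obtain ⟨ε, hε, hball⟩ := Metric.mem_nhds_iff.mp
      ((isOpen_lt continuous_const hz).mem_nhds (show b < φ z y₀ from hb))
    obtain ⟨N, hN⟩ := ENNReal.exists_nat_gt (hb.trans_le le_top).ne
    filter_upwards [eventually_ge_atTop N,
      tendsto_one_div_add_atTop_nhds_zero_nat.eventually_lt_const hε] with k hk hkε
    have hbk : b ≤ k := hN.le.trans (Nat.cast_le.mpr hk)
    refine le_iInf fun j => ?_
    split_ifs with hj
    · exact le_min (hball (Metric.mem_ball.mpr (hj.trans hkε))).le hbk
    · exact hbk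
  -- Continuity at y₀ gives the liminf bound as the balls shrink and the truncation level grows;
  -- Fatou passes it to integrals.
  have hfatou := h.trans_le ((lintegral_mono_ae hlim).trans (lintegral_liminf_le hF))
  obtain ⟨k, hk⟩ := (eventually_lt_of_lt_liminf hfatou).exists
  refine ⟨1 / ((k : ℝ) + 1), Nat.one_div_pos_of_nat, k, F k, hF k, hFk k, hk, ?_⟩
  filter_upwards [hc] with z hz y hy
  by_contra hlt
  have hopen : IsOpen {w | dist w y₀ < 1 / ((k : ℝ) + 1) ∧ φ z w < F k z} :=
    (isOpen_lt (continuous_id.dist continuous_const) continuous_const).inter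
      (isOpen_lt hz continuous_const)
  obtain ⟨j, hj1, hj2⟩ := (TopologicalSpace.denseRange_denseSeq Y).exists_mem_open hopen
    ⟨y, hy, not_le.mp hlt⟩
  refine absurd hj2 (not_lt.mpr ((iInf_le _ j).trans ?_))
  rw [if_pos hj1]
  exact min_le_left _ _

lemma sum_Icc_one_eq_sum_range (a : ℕ → ℝ) (n : ℕ) :
    ∑ t ∈ Finset.Icc 1 n, a t = ∑ j ∈ Finset.range n, a (j + 1) := by
  induction n with
  | zero => simp
  | succ n ih => rw [Finset.sum_Icc_succ_top (by omega), ih, Finset.sum_range_succ]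

/-- The finitely many exceptional terms add a constant, absorbed by (c' - c) n. -/
lemma eventually_sum_range_le {u v : ℕ → ℝ} {c c' : ℝ} (huv : ∀ᶠ t in atTop, u t ≤ v t)
    (hv : ∀ᶠ n : ℕ in atTop, ∑ j ∈ Finset.range n, v j ≤ c * n) (hc : c < c') :
    ∀ᶠ n : ℕ in atTop, ∑ j ∈ Finset.range n, u j ≤ c' * n := by
  obtain ⟨N, hN⟩ := eventually_atTop.mp huv
  have hdiff : ∀ n ≥ N, ∑ j ∈ Finset.range n, (u j - v j) ≤ ∑ j ∈ Finset.range N, (u j - v j) := by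
    intro n hn
    induction n, hn using Nat.le_induction with
    | base => exact le_rfl
    | succ n hn ih =>
      rw [Finset.sum_range_succ]
      linarith [hN n hn]
  have htop : Tendsto (fun n : ℕ => (c' - c) * (n : ℝ)) atTop atTop :=
    tendsto_natCast_atTop_atTop.const_mul_atTop (sub_pos.mpr hc)
  filter_upwards [hv, htop.eventually_ge_atTop (∑ j ∈ Finset.range N, (u j - v j)),
    eventually_ge_atTop N] with n h1 h2 h3
  have h4 := hdiff n h3
  rw [Finset.sum_sub_distrib] at h4
  linarith

lemma eventually_sum_range_le_of_tendsto_zero {e : ℕ → ℝ} (he : Tendsto e atTop (𝓝 0)) {c : ℝ}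
    (hc : 0 < c) : ∀ᶠ n : ℕ in atTop, ∑ j ∈ Finset.range n, e j ≤ c * n :=
  eventually_sum_range_le (he.eventually_le_const (half_pos hc))
    (Eventually.of_forall fun n => by simp [mul_comm]) (half_lt_self hc)

lemma ae_eventually_sum_seqShift_le {ν : Measure ℝ} [IsProbabilityMeasure ν]
    {f : (ℤ → ℝ) → ℝ} (hfm : Measurable f) (hf : Integrable f (iidLaw ν)) {c : ℝ}
    (hc : ∫ z, f z ∂(iidLaw ν) < c) :
    ∀ᵐ z ∂(iidLaw ν), ∀ᶠ n : ℕ in atTop,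
      ∑ j ∈ Finset.range n, f (seqShift ((j + 1 : ℕ) : ℤ) z) ≤ c * n := by
  have h := ae_eventually_birkhoffSum_le (ergodic_seqShift (ν := ν) one_ne_zero) hfm hf hc
  -- The extra shift by one matches likelihood sums that start at t = 1.
  filter_upwards [ae_seqShift h] with z hz
  filter_upwards [hz 1] with n hn
  simpa [birkhoffSum, seqShift_iterate, seqShift_seqShift] using hn

end Averages

/-! ### Wald's argument -/

section Consistency

variable {ν : Measure ℝ} [IsProbabilityMeasure ν]
  (hν : Integrable (fun y => y) ν) (hmean : ∫ y, y ∂ν = 0)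
  (hsq : Integrable (fun y => y ^ 2) ν) (hvar : ∫ y, y ^ 2 ∂ν = 1)
  (hndeg : ∀ a b : ℝ, ¬ ∀ᵐ y ∂ν, y = a ∨ y = b)
  {θ₀ θ₁ : Param} {K : Set Param} (hK : IsCompact K) (hKΘ : K ⊆ paramSpace) (hθ₀ : θ₀ ∈ K)
  (hlam : HasNegativeMean (iidLaw ν) fun z => extLog (lipSup K (egarch θ₀ z 0)))
  (hγδ : (θ₀.γ, θ₀.δ) ≠ (0, 0)) {s : ℝ} (hs : 0 < s)

/-- The likelihood contribution at time `t` as computed from the estimated volatility. -/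
noncomputable def estLik (s : ℝ) (x : ℤ → ℝ) (θ : Param) (t : ℕ) : ℝ :=
  x t ^ 2 * Real.exp (-Real.log (hHat s x θ t)) + Real.log (hHat s x θ t)

lemma logLik_eq_sum_range {s : ℝ} (hs : 0 < s) (x : ℤ → ℝ) (n : ℕ) (θ : Param) :
    logLik s x n θ = -(1 / 2) * ∑ j ∈ Finset.range n, estLik s x θ (j + 1) := by
  rw [logLik_eq hs, ← sum_Icc_one_eq_sum_range (estLik s x θ)]
  rfl

include hν hsq hvar hK hKΘ hθ₀ hlam in
-- At θ₀ the estimated log-volatility is eventually within η of the true one, so a contribution is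
-- at most exp(η) Z_t² + log σ_t² + η. The mean of this bound tends to 1 + E log σ_0² as η tends to
-- 0.
lemma ae_eventually_sum_estLik_le {c : ℝ} (hc : 1 + ∫ z, logVol θ₀ z 0 ∂(iidLaw ν) < c) (s : ℝ) :
    ∀ᵐ z ∂(iidLaw ν), ∀ᶠ n : ℕ in atTop,
      ∑ j ∈ Finset.range n, estLik s (egarch θ₀ z) θ₀ (j + 1) ≤ c * n := by
  set I := ∫ z, logVol θ₀ z 0 ∂(iidLaw ν)
  obtain ⟨η, hη, hηc⟩ : ∃ η > 0, Real.exp η + I + η < c := by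
    have hcont : Tendsto (fun η : ℝ => Real.exp η + I + η) (𝓝[>] 0) (𝓝 (Real.exp 0 + I + 0)) :=
      ((by fun_prop : Continuous fun η : ℝ => Real.exp η + I + η).tendsto 0).mono_left
        nhdsWithin_le_nhds
    rw [Real.exp_zero, add_zero] at hcont
    obtain ⟨η, h1, h2⟩ := ((hcont.eventually_lt_const hc).and self_mem_nhdsWithin).exists
    exact ⟨η, h2, h1⟩
  have hL := integrable_logVol (ν := ν) (hKΘ hθ₀) hν 0
  have hLm := measurable_logVol θ₀ 0
  have hz2 := (integrable_eval_sq hsq 0).const_mul (Real.exp η)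
  have hz2L : Integrable (fun z => Real.exp η * z 0 ^ 2 + logVol θ₀ z 0) (iidLaw ν) := hz2.add hL
  have hint : Integrable (fun z => Real.exp η * z 0 ^ 2 + logVol θ₀ z 0 + η) (iidLaw ν) :=
    hz2L.add (integrable_const η)
  have hval : ∫ z, (Real.exp η * z 0 ^ 2 + logVol θ₀ z 0 + η) ∂(iidLaw ν)
      = Real.exp η + I + η := by
    rw [integral_add hz2L (integrable_const η), integral_add hz2 hL,
      integral_const_mul, integral_eval_sq hvar]
    simp [I]
  obtain ⟨c', h1, h2⟩ := exists_between hηc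
  filter_upwards [ae_eventually_sum_seqShift_le (by fun_prop) hint (hval.trans_lt h1),
    ae_isContractive hK hθ₀ hlam, ae_statLog_eq_logVol hK hKΘ hθ₀ hlam hν] with z hz hcz hstat
  obtain ⟨E, hE0, hE⟩ := exists_abs_log_hHat_sub_statLog_le hK hKΘ hcz s
  refine eventually_sum_range_le ?_ hz h2
  filter_upwards [((tendsto_add_atTop_iff_nat 1).mpr hE0).eventually_le_const hη] with j hj
  have h3 := (hE (j + 1) θ₀ hθ₀).trans hj
  rw [hstat] at h3
  obtain ⟨h4, h5⟩ := abs_le.mp h3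
  rw [estLik, egarch_sq_mul_exp, logVol_seqShift, zero_add]
  have h6 : Real.exp (logVol θ₀ z ((j + 1 : ℕ) : ℤ) -
      Real.log (hHat s (egarch θ₀ z) θ₀ (j + 1))) ≤ Real.exp η :=
    Real.exp_le_exp.mpr (by linarith)
  have h7 := mul_le_mul_of_nonneg_right h6 (sq_nonneg (z ((j + 1 : ℕ) : ℤ)))
  simp only [seqShift, zero_add]
  linarith

include hν hmean hsq hvar hndeg hK hKΘ hθ₀ hlam hγδ hs in
/-- Near a wrong parameter the likelihood is eventually smaller than at the true parameter. -/
theorem exists_ball_ae_eventually_logLik_lt (hθ₁ : θ₁ ∈ K) (hne : θ₁ ≠ θ₀) :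
    ∃ r > 0, ∀ᵐ z ∂(iidLaw ν), ∀ᶠ n : ℕ in atTop, ∀ θ ∈ K, dist θ θ₁ < r →
      logLik s (egarch θ₀ z) n θ < logLik s (egarch θ₀ z) n θ₀ := by
  set I := ∫ z, logVol θ₀ z 0 ∂(iidLaw ν) with hI
  set m := lowerBound K with hm
  have hcontr := ae_isContractive hK hθ₀ hlam
  obtain ⟨r, hr, M, F, hF, hFM, hlt, hball⟩ := exists_ball_lt_lintegral (Y := K) (y₀ := ⟨θ₁, hθ₁⟩)
    (φ := fun z θ => ENNReal.ofReal (statLik θ₀ θ z 0 - m))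
    (fun θ => ((measurable_statLik θ₀ θ 0).sub_const m).ennreal_ofReal)
    (by
      filter_upwards [hcontr] with z hz
      have h1 : Continuous fun θ : K => statLog (egarch θ₀ z) θ 0 :=
        (continuousOn_statLog hK hKΘ hz 0).domRestrict
      unfold statLik
      exact ENNReal.continuous_ofReal.comp (by fun_prop))
    (lt_lintegral_statLik hν hmean hsq hvar hndeg hK hKΘ hθ₀ hlam hγδ hθ₁ hne)
  have hFtop : ∀ z, F z ≠ ∞ := fun z => ((hFM z).trans_lt (ENNReal.natCast_lt_top M)).ne
  set f : (ℤ → ℝ) → ℝ := fun z => (F z).toReal with hf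
  have hfm : Measurable f := hF.ennreal_toReal
  have hf0 : ∀ z, 0 ≤ f z := fun z => ENNReal.toReal_nonneg
  have hfM : ∀ z, f z ≤ M := fun z => by
    simpa using ENNReal.toReal_mono (ENNReal.natCast_ne_top M) (hFM z)
  have hfint : Integrable f (iidLaw ν) :=
    Integrable.of_bound hfm.aestronglyMeasurable (M : ℝ)
      (ae_of_all _ fun z => by rw [Real.norm_of_nonneg (hf0 z)]; exact hfM z)
  have hfI : 1 + I - m < ∫ z, f z ∂(iidLaw ν) := by
    have e : ∫⁻ z, F z ∂(iidLaw ν) = ENNReal.ofReal (∫ z, f z ∂(iidLaw ν)) := by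
      rw [ofReal_integral_eq_lintegral_ofReal hfint (ae_of_all _ hf0)]
      exact lintegral_congr fun z => (ENNReal.ofReal_toReal (hFtop z)).symm
    rw [e] at hlt
    exact (ENNReal.ofReal_lt_ofReal_iff'.mp hlt).1
  obtain ⟨c, hc1, hc2⟩ := exists_between hfI
  -- One third of the gap pays for the upper bound at θ₀, one for the accumulated estimation error,
  -- and one keeps the inequality strict.
  set κ := (c + m - (1 + I)) / 3 with hκ
  have hκ0 : 0 < κ := by
    rw [hκ]
    linarith
  have hneg : ∫ z, -f z ∂(iidLaw ν) < -c := by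
    rw [integral_neg]
    linarith
  refine ⟨r, hr, ?_⟩
  filter_upwards [ae_eventually_sum_estLik_le hν hsq hvar hK hKΘ hθ₀ hlam
    (c := 1 + I + κ) (by linarith) s, ae_eventually_sum_seqShift_le hfm.neg hfint.neg hneg,
    ae_seqShift hball, hcontr] with z hup hlow hFz hcz
  obtain ⟨E, hE0, hE⟩ := exists_abs_log_hHat_sub_statLog_le hK hKΘ hcz s
  have hE1 : Tendsto (fun j => ((M : ℝ) + 1) * E (j + 1)) atTop (𝓝 0) := by
    simpa using ((tendsto_add_atTop_iff_nat 1).mpr hE0).const_mul ((M : ℝ) + 1)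
  filter_upwards [hup, hlow, eventually_sum_range_le_of_tendsto_zero hE1 hκ0,
    eventually_gt_atTop 0] with n h1 h2 h3 hn θ hθ hdist
  -- The estimation error multiplies x_t² / h_t, which is unbounded. Working with the truncated
  -- minorant f ≤ M turns its effect into the deterministic loss (M + 1) E.
  have hterm : ∀ j : ℕ, f (seqShift ((j + 1 : ℕ) : ℤ) z) + m - ((M : ℝ) + 1) * E (j + 1)
      ≤ estLik s (egarch θ₀ z) θ (j + 1) := by
    intro j
    set t : ℤ := ((j + 1 : ℕ) : ℤ) with ht
    set l := statLog (egarch θ₀ z) θ t with hl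
    set lhat := Real.log (hHat s (egarch θ₀ z) θ (j + 1)) with hlhat
    have hdiff : |lhat - l| ≤ E (j + 1) := hE (j + 1) θ hθ
    have hEnn : 0 ≤ E (j + 1) := (abs_nonneg _).trans hdiff
    obtain ⟨hd1, hd2⟩ := abs_le.mp hdiff
    have hml : m ≤ l := lowerBound_le_statLog hK hKΘ hcz hθ t
    set a := egarch θ₀ z t ^ 2 * Real.exp (-l) with ha
    have ha0 : 0 ≤ a := mul_nonneg (sq_nonneg _) (Real.exp_pos _).le
    have hfa : f (seqShift t z) ≤ a + (l - m) := by
      have h4 := hFz t ⟨θ, hθ⟩ hdist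
      rw [statLik_seqShift, zero_add, statLik, ← hl, ← ha, add_sub_assoc] at h4
      have h5 := ENNReal.toReal_mono ENNReal.ofReal_ne_top h4
      rwa [ENNReal.toReal_ofReal (by linarith)] at h5
    have hexp : a * (1 - E (j + 1)) ≤ egarch θ₀ z t ^ 2 * Real.exp (-lhat) := by
      have e : egarch θ₀ z t ^ 2 * Real.exp (-lhat) = a * Real.exp (l - lhat) := by
        rw [ha, mul_assoc, ← Real.exp_add]
        congr 2
        ring
      rw [e]
      refine mul_le_mul_of_nonneg_left ?_ ha0
      have := Real.add_one_le_exp (l - lhat)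
      linarith
    have hest : estLik s (egarch θ₀ z) θ (j + 1) = egarch θ₀ z t ^ 2 * Real.exp (-lhat) + lhat :=
      rfl
    have hpos : 0 ≤ egarch θ₀ z t ^ 2 * Real.exp (-lhat) :=
      mul_nonneg (sq_nonneg _) (Real.exp_pos _).le
    have hfn := hf0 (seqShift t z)
    have hfMt := hfM (seqShift t z)
    rw [hest]
    -- For E ≤ 1 the factor 1 - E may multiply the bound on f. For E ≥ 1 the loss M E already
    -- exceeds f, and the log term alone suffices.
    rcases le_total (E (j + 1)) 1 with hE1' | hE1'
    · have h6 : f (seqShift t z) * (1 - E (j + 1)) ≤ (a + (l - m)) * (1 - E (j + 1)) :=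
        mul_le_mul_of_nonneg_right hfa (by linarith)
      have h7 : f (seqShift t z) * E (j + 1) ≤ M * E (j + 1) :=
        mul_le_mul_of_nonneg_right hfMt hEnn
      have h8 : 0 ≤ (l - m) * E (j + 1) := mul_nonneg (by linarith) hEnn
      linarith
    · have h7 : (M : ℝ) * 1 ≤ M * E (j + 1) :=
        mul_le_mul_of_nonneg_left hE1' (Nat.cast_nonneg M)
      linarith
  have hsum := Finset.sum_le_sum fun j (_ : j ∈ Finset.range n) => hterm j
  rw [Finset.sum_sub_distrib, Finset.sum_add_distrib, Finset.sum_const, Finset.card_range,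
    nsmul_eq_mul] at hsum
  simp only [Pi.neg_apply, Finset.sum_neg_distrib] at h2
  have hn' : (0 : ℝ) < n := Nat.cast_pos.mpr hn
  have hgap : (1 + I + κ) * n < c * n + n * m - κ * n := by
    have e : c = 1 + I - m + 3 * κ := by rw [hκ]; ring
    rw [e]
    nlinarith [mul_pos hκ0 hn']
  rw [logLik_eq_sum_range hs, logLik_eq_sum_range hs]
  linarith

include hν hmean hsq hvar hndeg hK hKΘ hθ₀ hlam hγδ hs in
/-- Strong consistency along the canonical EGARCH process. -/
theorem ae_tendsto_of_isQMLE : ∀ᵐ z ∂(iidLaw ν), ∀ ϑ : ℕ → Param,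
    (∀ n, 1 ≤ n → IsQMLE s (egarch θ₀ z) K n (ϑ n)) → Tendsto ϑ atTop (𝓝 θ₀) := by
  have haway : ∀ ε : ℝ, 0 < ε → ∀ᵐ z ∂(iidLaw ν), ∀ᶠ n : ℕ in atTop,
      ∀ θ ∈ K \ Metric.ball θ₀ ε, logLik s (egarch θ₀ z) n θ < logLik s (egarch θ₀ z) n θ₀ := by
    intro ε hε
    -- Compact induction replaces an explicit finite subcover: the property passes to subsets and
    -- finite unions and holds near each point.
    refine (hK.diff Metric.isOpen_ball).induction_on (p := fun S => ∀ᵐ z ∂(iidLaw ν),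
      ∀ᶠ n : ℕ in atTop, ∀ θ ∈ S, logLik s (egarch θ₀ z) n θ < logLik s (egarch θ₀ z) n θ₀)
      ?_ ?_ ?_ ?_
    · simp
    · intro S S' hSS' h
      filter_upwards [h] with z hz
      filter_upwards [hz] with n hn θ hθ using hn θ (hSS' hθ)
    · intro S S' h h'
      filter_upwards [h, h'] with z hz hz'
      filter_upwards [hz, hz'] with n hn hn' θ hθ
      exact hθ.elim (hn θ) (hn' θ)
    · intro θ₁ hθ₁
      have hne : θ₁ ≠ θ₀ := fun h => hθ₁.2 (h ▸ Metric.mem_ball_self hε)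
      obtain ⟨r, hr, h⟩ := exists_ball_ae_eventually_logLik_lt hν hmean hsq hvar hndeg hK hKΘ hθ₀
        hlam hγδ hs hθ₁.1 hne
      refine ⟨Metric.ball θ₁ r ∩ K, ?_, ?_⟩
      · exact inter_mem (mem_nhdsWithin_of_mem_nhds (Metric.ball_mem_nhds θ₁ hr))
          (mem_of_superset self_mem_nhdsWithin Set.sdiff_subset)
      · filter_upwards [h] with z hz
        filter_upwards [hz] with n hn θ hθ using hn θ hθ.2 hθ.1
  -- Countably many radii give a single null set for all ε.
  have hall := ae_all_iff.mpr fun k : ℕ => haway (1 / ((k : ℝ) + 1)) Nat.one_div_pos_of_nat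
  filter_upwards [hall] with z hz ϑ hϑ
  rw [Metric.tendsto_atTop']
  intro ε hε
  obtain ⟨k, hk⟩ := exists_nat_one_div_lt hε
  obtain ⟨N, hN⟩ := eventually_atTop.mp (hz k)
  refine ⟨N, fun n hn => ?_⟩
  have hq := hϑ n (Nat.one_le_of_lt hn)
  by_contra hfar
  have hout : ϑ n ∉ Metric.ball θ₀ (1 / ((k : ℝ) + 1)) := fun h =>
    hfar ((Metric.mem_ball.mp h).trans hk)
  exact absurd (hN n hn.le (ϑ n) ⟨hq.1, hout⟩) (not_lt.mpr (hq.2 hθ₀))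

end Consistency

end EGARCH

theorem theorem5p1 {Ω : Type*} [MeasurableSpace Ω] (P : Measure Ω) [IsProbabilityMeasure P]
    (Z X σ : ℤ → Ω → ℝ) (θ₀ : EGARCH.Param)
    -- a stationary EGARCH process with `0 ≤ β₀ < 1`, `δ₀ ≥ |γ₀|`, `(γ₀, δ₀) ≠ (0, 0)`
    (hXσ : EGARCH.IsStationaryEGARCH P θ₀ Z X σ)
    (hβ₀ : 0 ≤ θ₀.β ∧ θ₀.β < 1) (hδ₀ : |θ₀.γ| ≤ θ₀.δ) (hγδ : (θ₀.γ, θ₀.δ) ≠ (0, 0))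
    -- the law of `Z_0` is not concentrated at two points
    (hZ : ∀ a b : ℝ, P {ω | Z 0 ω = a ∨ Z 0 ω = b} ≠ 1)
    (K : Set EGARCH.Param) (hK : IsCompact K) (hKΘ : K ⊆ EGARCH.paramSpace) (hθ₀ : θ₀ ∈ K)
    -- `E log ‖λ₀‖_K < 0`
    (hlam : EGARCH.HasNegativeMean P fun ω =>
      EGARCH.extLog (EGARCH.supNorm K (EGARCH.lipBound K (X 0 ω))))
    -- the initial value of the recursion for the volatility estimate
    (s : ℝ) (hs : 0 < s) :
    (∀ (n : ℕ) (ω : Ω), ∃ θ, EGARCH.IsQMLE s (fun t => X t ω) K n θ) ∧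
    ∀ θhat : ℕ → Ω → EGARCH.Param,
      (∀ n, 1 ≤ n → ∀ᵐ ω ∂P, EGARCH.IsQMLE s (fun t => X t ω) K n (θhat n ω)) →
      ∀ᵐ ω ∂P, Tendsto (fun n => θhat n ω) atTop (𝓝 θ₀) := by
  refine ⟨fun n ω => EGARCH.exists_isQMLE hK ⟨θ₀, hθ₀⟩ hs _ n, fun θhat hhat => ?_⟩
  have := EGARCH.isProbabilityMeasure_innovation hXσ
  have hZm := hXσ.measurable_Z 0
  have hmap := EGARCH.map_innovations_eq hXσ
  have hZall := EGARCH.measurable_innovations hXσ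
  have hX := EGARCH.ae_eq_egarch hXσ (hKΘ hθ₀)
  have hmean : ∫ y, y ∂(P.map (Z 0)) = 0 := by
    rw [integral_map hZm.aemeasurable (by fun_prop)]
    exact hXσ.mean
  have hsq : Integrable (fun y => y ^ 2) (P.map (Z 0)) :=
    (integrable_map_measure (by fun_prop) hZm.aemeasurable).mpr hXσ.memLp.integrable_sq
  have hvar : ∫ y, y ^ 2 ∂(P.map (Z 0)) = 1 := by
    rw [integral_map hZm.aemeasurable (by fun_prop)]
    exact hXσ.variance
  have hndeg : ∀ a b : ℝ, ¬ ∀ᵐ y ∂(P.map (Z 0)), y = a ∨ y = b := fun a b h => by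
    have h1 : ∀ᵐ ω ∂P, Z 0 ω = a ∨ Z 0 ω = b := ae_of_ae_map hZm.aemeasurable h
    refine hZ a b ?_
    rw [← measure_univ (μ := P)]
    exact measure_congr (ae_eq_univ.mpr h1)
  -- The moment condition moves to the canonical space because X_0 is almost surely `egarch`
  -- evaluated at the innovations.
  have hlam' : EGARCH.HasNegativeMean (EGARCH.iidLaw (P.map (Z 0))) fun z =>
      EGARCH.extLog (EGARCH.lipSup K (EGARCH.egarch θ₀ z 0)) := by
    have hext : Measurable fun z => EGARCH.extLog (EGARCH.lipSup K (EGARCH.egarch θ₀ z 0)) :=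
      ENNReal.measurable_log.comp ((EGARCH.measurable_lipSup hK ⟨θ₀, hθ₀⟩).comp
        (EGARCH.measurable_egarch θ₀ 0)).ennreal_ofReal
    rw [EGARCH.HasNegativeMean, ← hmap, lintegral_map (by fun_prop) hZall,
      lintegral_map (by fun_prop) hZall]
    have hX0 : ∀ᵐ ω ∂P, EGARCH.egarch θ₀ (fun k => Z k ω) 0 = X 0 ω := by
      filter_upwards [hX] with ω hω using (congrFun hω 0).symm
    have e : ∀ g : EReal → ℝ≥0∞, ∫⁻ ω, g (EGARCH.extLog (EGARCH.lipSup K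
        (EGARCH.egarch θ₀ (fun k => Z k ω) 0))) ∂P =
        ∫⁻ ω, g (EGARCH.extLog (EGARCH.supNorm K (EGARCH.lipBound K (X 0 ω)))) ∂P := fun g => by
      refine lintegral_congr_ae ?_
      filter_upwards [hX0] with ω hω
      rw [hω, EGARCH.lipSup]
    exact (e EReal.toENNReal).trans_lt (hlam.trans_eq (e fun y => (-y).toENNReal).symm)
  -- The almost sure event here covers all sequences of maximizers at once, so no measurability of
  -- the estimators is needed.
  have hmain := EGARCH.ae_tendsto_of_isQMLE (EGARCH.integrable_innovation hXσ) hmean hsq hvar hndeg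
    hK hKΘ hθ₀ hlam' hγδ hs
  rw [← hmap] at hmain
  filter_upwards [ae_of_ae_map hZall.aemeasurable hmain, hX,
    ae_all_iff.mpr fun n => ae_all_iff.mpr (hhat n)] with ω h1 h2 h3
  exact h1 (fun n => θhat n ω) fun n hn => h2 ▸ h3 n hn
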